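/- Setting. Let $\mathbb F_q$ be a finite field of characteristic $\neq 2,3$, let $f(x)=x^3+Ax+B$ with $A,B\in\mathbb F_q$ and $4A^3+27B^2\ne 0$, and let $E: y^2=f(x)$. Let $\varphi(x,y)=(x^q,y^q)$ on $E(\mathbb F_{q^3})$ and $T_3=\{Q\in E(\mathbb F_{q^3}) : Q+\varphi(Q)+\varphi^2(Q)=P_\infty\}$. Assume that $T_3=\langle P\rangle$ is cyclic of prime order $p>10800$. For $Q\in T_3\setminus\{P_\infty\}$ let $h_Q=y-(\alpha_1x+\alpha_0)$, $\alpha_i\in\mathbb F_q$, be the equation of the line through $Q,\varphi(Q),\varphi^2(Q)$. Let $s$ be the residue modulo $p$ with $\varphi(P)=sP$, let $$M=\left\{\tfrac{\pm3}{2s+1},\tfrac{s-4}{3s},\tfrac{4s-1}{2s+1},\tfrac{s+5}{3(s+1)},\tfrac{4s+5}{2s+1}\right\}\subseteq\mathbb Z/p\mathbb Z,$$ and let $\mathcal M$ be the set of odd integers in $[0,p)$ whose residue lies in $M$. Doubling. For $h=y-(\alpha_1x+\alpha_0)$ let $D(h)=y-(u_1x+u_0)/c$, where $u_1=4B\alpha_1^4-4A\alpha_1^3\alpha_0+4A^2\alpha_1^2-4\alpha_1\alpha_0^3+36B\alpha_1\alpha_0-12A\alpha_0^2$,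 $u_0=-A^2\alpha_1^4-8B\alpha_1^3\alpha_0+2A\alpha_1^2\alpha_0^2+6AB\alpha_1^2-8A^2\alpha_1\alpha_0-\alpha_0^4-18B\alpha_0^2+4A^3+27B^2$, $c=8B\alpha_1^3-8A\alpha_1^2\alpha_0-8\alpha_0^3$. Subalgorithm. For two lines $h_Q,h_R$ the polynomial $S_{Q,R}=S_1(x)+yS_2(x)=(a_4x^4+\dots+a_0)+y(b_3x^3+\dots+b_0)$, with divisor $\sum_{0\le i,j\le2}(\varphi^i(Q)+\varphi^j(R))-9P_\infty$ on $E$, is unique up to a nonzero constant and depends only on $h_Q$ and $h_R$; the $a_i,b_i$ are computed as explicit polynomials with integer coefficients in $A$, $B$ and the coefficients of the two lines, and scaled so that $b_3=1$ whenever $b_3\neq0$. For a monic cubic $W=x^3+w_2x^2+w_1x+w_0$ and $S=S_1+yS_2$ with $b_3=1$, let $L(W,S)$ be the linear system in $(\gamma_1,\gamma_0)$ with augmented matrix $$\begin{pmatrix} w_0(w_2-b_2)&b_0-w_0&w_0a_3-a_4w_2w_0-a_0\\ w_0(w_1-b_1)&b_0w_2-w_0b_2&w_0a_2-a_4w_1w_0-a_0w_2\\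 w_0(w_0-b_0)&b_0w_1-b_1w_0&w_0a_1-a_4w_0^2-a_0w_1\end{pmatrix},$$ whose solution gives the line $y-(\gamma_1x+\gamma_0)$. For a line $h$ write $\bar h(x,y)=-h(x,-y)$. The output $\mathrm{Subalg}(g_1,g_2,g_3,g_4)$ is obtained as follows. (1) If $g_1=g_2$, return $\bar g_1$; if $g_3=g_4$, return $\bar g_3$. (2) Compute $S=S_1+yS_2$ from $g_1,g_2$ and $T=T_1+yT_2$ from $g_3,g_4$. If $g_1=\bar g_2$, return the solution of $L(W,T)$, where $W$ is the monic multiple of $S_1$; if $g_3=\bar g_4$, return the solution of $L(W,S)$, where $W$ is the monic multiple of $T_1$. (3) Otherwise run, in any order, through the distinct monic irreducible factors $W$ of degree $3$ in $\mathbb F_q[x]$ of $\gcd(fS_2^2-S_1^2,\,fT_2^2-T_1^2)$. If $W\ne S_2$, solve $L(W,S)$, and return the solution $y-(\gamma_1x+\gamma_0)$ if $W\mid(\gamma_1x+\gamma_0)T_2+T_1$, else pass to the next $W$. If $W=S_2$, return the solution of $L(W,T)$. Proposition. Let $0<m<p$, let $m=\sum_{i=0}^{\ell-1}m_i2^i$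 with $m_i\in\{0,1\}$ and $m_{\ell-1}=1$, and let $k_i=\sum_{j=i}^{\ell-1}m_j2^{j-i}$. For $i$ from $\ell-1$ down to $0$ define $u_i,v_i$ recursively as follows. * $u_{\ell-1}=h_P$, $v_{\ell-1}=h_{2P}$. * $(u_{\ell-2},v_{\ell-2})=(h_{2P},h_{3P})$ if $m_{\ell-2}=0$, and $(h_{3P},h_{4P})$ if $m_{\ell-2}=1$. * For $0\le i\le\ell-3$ put $(u_i,v_i)=(D(u_{i+1}),w_i)$ if $m_i=0$ and $(u_i,v_i)=(w_i,D(v_{i+1}))$ if $m_i=1$, where - (general case) if $k_i,k_i+1\notin\mathcal M$, then $w_i=\mathrm{Subalg}(h_P,D(u_{i+1}),u_{i+1},v_{i+1})$; - (special case) if $k_i\in\mathcal M$ or $k_i+1\in\mathcal M$, then $$w_i=\begin{cases}\mathrm{Subalg}(h_{3P},D^2(u_{i+2}),h_{7P},D^3(u_{i+3}))& m_{i+1}=m_{i+2}=1,\\ \mathrm{Subalg}(h_{3P},D^3(u_{i+3}),h_{-5P},D^3(v_{i+3}))& m_{i+1}=1,\ m_{i+2}=0,\\ \mathrm{Subalg}(h_{-3P},D^3(v_{i+3}),h_{5P},D^3(u_{i+3}))&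 m_{i+1}=0,\ m_{i+2}=1,\\ \mathrm{Subalg}(h_{-3P},D^2(v_{i+2}),h_{-7P},D^3(v_{i+3}))& m_{i+1}=m_{i+2}=0.\end{cases}$$ Then for every $i\in\{0,\dots,\ell-1\}$ all computations needed for $u_i$ succeed and $u_i=h_{k_iP}$; and, if $k_i+1\ne p$, all computations needed for $v_i$ succeed and $v_i=h_{(k_i+1)P}$. (The exception $k_i+1=p$ occurs only for $m=p-1$, $i=0$, where $h_{(k_i+1)P}=h_{P_\infty}$ is not defined.) -/

import Mathlib

open Polynomial

namespace T3

noncomputable section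

section Curve

variable {F : Type*} [Field F]

/-- The cubic `f = x³ + A x + B`. -/
def cubic (A B : F) : F[X] := X ^ 3 + C A * X + C B

/-- The curve `y² = x³ + A x + B` in short Weierstrass form. -/
def curve (A B : F) : WeierstrassCurve F := ⟨0, 0, 0, A, B⟩

/-- The points of `y² = x³ + A x + B` over an extension `K` of `F`, with the point at infinity. -/
abbrev Points (K : Type*) [Field K] [Algebra F K] (A B : F) : Type _ :=
  ((curve A B).baseChange K).toAffine.Point

variable [Fintype F] {K : Type*} [Field K] [DecidableEq K] [Algebra F K] {A B : F}

/-- The Frobenius endomorphism `(x, y) ↦ (x ^ q, y ^ q)` of the group of `K`-points, `q = #F`. -/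
def frob : Points K A B →+ Points K A B :=
  WeierstrassCurve.Affine.Point.map (W' := curve A B) (FiniteField.frobeniusAlgHom F K)

/-- The trace zero subgroup `{Q | Q + φ(Q) + φ²(Q) = 0}`. -/
def traceZero (K : Type*) [Field K] [DecidableEq K] [Algebra F K] (A B : F) :
    AddSubgroup (Points K A B) :=
  (AddMonoidHom.id (Points K A B) + frob + frob.comp frob).ker

end Curve

/-- The non-vertical line `y - (a₁ x + a₀)`, given by its two coefficients. -/
@[ext]
structure Line (F : Type*) where
  a₁ : F
  a₀ : F

section Lines

variable {F : Type*} [Field F]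

/-- The line `y + (a₁ x + a₀)`, that is `-h(x, -y)` for `h = y - (a₁ x + a₀)`. -/
def Line.neg (L : Line F) : Line F := ⟨-L.a₁, -L.a₀⟩

variable [Fintype F] {K : Type*} [Field K] [Algebra F K] {A B : F}

/-- `L` is the line `h_Q` through `Q`, `φ(Q)`, `φ²(Q)`: the point `Q = (x, y)` is affine and lies on
`L` (hence so do its conjugates, `L` being defined over `F`), and `L` meets the curve exactly in
`Q`, `φ(Q)`, `φ²(Q)`, counted with multiplicity. -/
def IsLineOf (L : Line F) (Q : Points K A B) : Prop :=
  ∃ (x y : K) (h : ((curve A B).baseChange K).toAffine.Nonsingular x y),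
    Q = WeierstrassCurve.Affine.Point.some x y h ∧
    y = algebraMap F K L.a₁ * x + algebraMap F K L.a₀ ∧
    (cubic A B - (C L.a₁ * X + C L.a₀) ^ 2).map (algebraMap F K) =
      (X - C x) * (X - C (x ^ Fintype.card F)) * (X - C (x ^ Fintype.card F ^ 2))

/-- In odd characteristic a point has at most one such line. -/
theorem IsLineOf.unique (h2 : ringChar F ≠ 2) {L L' : Line F} {Q : Points K A B}
    (h : IsLineOf L Q) (h' : IsLineOf L' Q) : L = L' := by
  obtain ⟨x, y, hn, rfl, hy, hf⟩ := h
  obtain ⟨x', y', hn', he, hy', hf'⟩ := h'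
  obtain ⟨rfl, rfl⟩ := WeierstrassCurve.Affine.Point.some.inj he
  have h2F : (2 : F) ≠ 0 := Ring.two_ne_zero h2
  have hinj := (algebraMap F K).injective
  have hpoly := Polynomial.map_injective _ hinj (hf.trans hf'.symm)
  have hprod : (C (L.a₁ - L'.a₁) * X + C (L.a₀ - L'.a₀)) *
      (C (L.a₁ + L'.a₁) * X + C (L.a₀ + L'.a₀)) = 0 := by
    simp only [C_add, C_sub]
    linear_combination -hpoly
  rcases mul_eq_zero.1 hprod with h0 | h0
  · have e1 := congrArg (fun g => coeff g 1) h0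
    have e0 := congrArg (fun g => coeff g 0) h0
    simp [coeff_X, coeff_C] at e1 e0
    exact Line.ext (sub_eq_zero.1 e1) (sub_eq_zero.1 e0)
  · have e1 := congrArg (fun g => coeff g 1) h0
    have e0 := congrArg (fun g => coeff g 0) h0
    simp [coeff_X, coeff_C] at e1 e0
    have f1 : L'.a₁ = -L.a₁ := by linear_combination e1
    have f0 : L'.a₀ = -L.a₀ := by linear_combination e0
    have h2K : (2 : K) ≠ 0 := by
      have h2' := (_root_.map_ne_zero (algebraMap F K)).2 h2F
      rwa [map_ofNat] at h2'
    have hy0 : y = 0 := by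
      rw [f1, f0, map_neg, map_neg] at hy'
      have : (2 : K) * y = 0 := by linear_combination hy + hy'
      exact (mul_eq_zero.1 this).resolve_left h2K
    by_cases ha : L.a₁ = 0
    · have : algebraMap F K L.a₀ = 0 := by rw [hy0, ha] at hy; simpa using hy.symm
      have hb : L.a₀ = 0 := (map_eq_zero _).1 this
      exact Line.ext (by rw [f1, ha, neg_zero]) (by rw [f0, hb, neg_zero])
    · exfalso
      have hx : x = algebraMap F K (-L.a₀ / L.a₁) := by
        have : algebraMap F K L.a₁ ≠ 0 := (_root_.map_ne_zero _).2 ha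
        rw [map_div₀, map_neg, eq_div_iff this]
        linear_combination -hy + hy0
      have hxq : x ^ Fintype.card F = x := by rw [hx, ← map_pow, FiniteField.pow_card]
      have hxq2 : x ^ Fintype.card F ^ 2 = x := by rw [pow_two, pow_mul, hxq, hxq]
      rw [hxq, hxq2] at hf
      have hd := congrArg (fun g => (derivative g).eval x) hf
      simp [cubic, pow_two (C _ * X + C _)] at hd
      rw [WeierstrassCurve.Affine.nonsingular_iff] at hn
      simp [curve, hy0] at hn
      apply hn.2
      linear_combination (-1 : K) * hd - 2 * algebraMap F K L.a₁ * (hy0 - hy)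

open Classical in
/-- The line `h_Q`, when it exists. -/
def lineOf (Q : Points K A B) : Option (Line F) :=
  if h : ∃ L : Line F, IsLineOf L Q then some h.choose else none

end Lines

section Formulas

variable {F : Type*} [Field F]

/-! Doubling: `h_{2Q} = c y - (u₁ x + u₀)` up to a constant, for `h_Q = y - (a₁ x + a₀)`. -/

def dblU1 (A B a₁ a₀ : F) : F :=
  4 * B * a₁ ^ 4 - 4 * A * a₁ ^ 3 * a₀ + 4 * A ^ 2 * a₁ ^ 2 - 4 * a₁ * a₀ ^ 3 + 36 * B * a₁ *
    a₀ - 12 * A * a₀ ^ 2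

def dblU0 (A B a₁ a₀ : F) : F :=
  -A ^ 2 * a₁ ^ 4 - 8 * B * a₁ ^ 3 * a₀ + 2 * A * a₁ ^ 2 * a₀ ^ 2 + 6 * A * B * a₁ ^ 2 - 8 *
    A ^ 2 * a₁ * a₀ - a₀ ^ 4 - 18 * B * a₀ ^ 2 + 4 * A ^ 3 + 27 * B ^ 2

def dblC (A B a₁ a₀ : F) : F :=
  8 * B * a₁ ^ 3 - 8 * A * a₁ ^ 2 * a₀ - 8 * a₀ ^ 3

open Classical in
/-- The doubling `D`, which divides the doubling formulas by `c`. It fails if `c = 0`. -/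
def dbl (A B : F) (L : Line F) : Option (Line F) :=
  if dblC A B L.a₁ L.a₀ = 0 then none
  else some ⟨dblU1 A B L.a₁ L.a₀ / dblC A B L.a₁ L.a₀, dblU0 A B L.a₁ L.a₀ / dblC A B L.a₁ L.a₀⟩

/-! The coefficients of `S_{Q,R} = (a₄x⁴ + a₃x³ + a₂x² + a₁x + a₀) + y (b₃x³ + b₂x² + b₁x + b₀)` for
`h_Q = y - (a₁ x + a₀)` and `h_R = y - (b₁ x + b₀)`: below `sA4, …, sA0` are the coefficients of the
first summand, and `sB3, …, sB0` those of the second one. -/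

def sA4 (A B a₁ a₀ b₁ b₀ : F) : F :=
  -a₁ ^ 3 * b₁ * b₀ ^ 2 - 3 * B * a₁ ^ 3 * b₁ + 2 * A * a₁ ^ 3 * b₀ + 2 * a₁ ^ 2 * a₀ * b₁ ^
    2 * b₀ + A * a₁ ^ 2 * a₀ * b₁ - 6 * B * a₁ ^ 2 * b₁ ^ 2 + 3 * A * a₁ ^ 2 * b₁ * b₀ + A ^
    2 * a₁ ^ 2 - a₁ * a₀ ^ 2 * b₁ ^ 3 + 6 * a₁ * a₀ ^ 2 * b₀ + 3 * A * a₁ * a₀ * b₁ ^ 2 + 3 *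
    a₁ * a₀ * b₀ ^ 2 + 9 * B * a₁ * a₀ - 3 * B * a₁ * b₁ ^ 3 + A * a₁ * b₁ ^ 2 * b₀ + 2 * A ^
    2 * a₁ * b₁ - 3 * a₁ * b₀ ^ 3 + 9 * B * a₁ * b₀ - 3 * a₀ ^ 3 * b₁ + 3 * a₀ ^ 2 * b₁ * b₀ -
    3 * A * a₀ ^ 2 + 2 * A * a₀ * b₁ ^ 3 + 6 * a₀ * b₁ * b₀ ^ 2 + 9 * B * a₀ * b₁ - 6 * A *
    a₀ * b₀ + A ^ 2 * b₁ ^ 2 + 9 * B * b₁ * b₀ - 3 * A * b₀ ^ 2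

def sA3 (A B a₁ a₀ b₁ b₀ : F) : F :=
  4 * B * a₁ ^ 3 * b₁ ^ 3 - 2 * A * a₁ ^ 3 * b₁ ^ 2 * b₀ + A ^ 2 * a₁ ^ 3 * b₁ - a₁ ^ 3 * b₀ ^
    3 + 9 * B * a₁ ^ 3 * b₀ - 2 * A * a₁ ^ 2 * a₀ * b₁ ^ 3 - a₁ ^ 2 * a₀ * b₁ * b₀ ^ 2 + 3 *
    B * a₁ ^ 2 * a₀ * b₁ - 7 * A * a₁ ^ 2 * a₀ * b₀ + A ^ 2 * a₁ ^ 2 * b₁ ^ 2 - 6 * B * a₁ ^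
    2 * b₁ * b₀ + 3 * A * a₁ ^ 2 * b₀ ^ 2 + 6 * A * B * a₁ ^ 2 - a₁ * a₀ ^ 2 * b₁ ^ 2 * b₀ +
    A * a₁ * a₀ ^ 2 * b₁ - 6 * B * a₁ * a₀ * b₁ ^ 2 + 12 * A * a₁ * a₀ * b₁ * b₀ - 8 * A ^ 2 *
    a₁ * a₀ + A ^ 2 * a₁ * b₁ ^ 3 + 3 * B * a₁ * b₁ ^ 2 * b₀ + A * a₁ * b₁ * b₀ ^ 2 - 6 * A *
    B * a₁ * b₁ + 4 * A ^ 2 * a₁ * b₀ - a₀ ^ 3 * b₁ ^ 3 - 3 * a₀ ^ 3 * b₀ + 3 * A * a₀ ^ 2 *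
    b₁ ^ 2 + 21 * a₀ ^ 2 * b₀ ^ 2 - 18 * B * a₀ ^ 2 + 9 * B * a₀ * b₁ ^ 3 - 7 * A * a₀ * b₁ ^
    2 * b₀ + 4 * A ^ 2 * a₀ * b₁ - 3 * a₀ * b₀ ^ 3 + 18 * B * a₀ * b₀ + 6 * A * B * b₁ ^ 2 -
    8 * A ^ 2 * b₁ * b₀ - 18 * B * b₀ ^ 2 + 4 * A ^ 3 + 27 * B ^ 2

def sA2 (A B a₁ a₀ b₁ b₀ : F) : F :=
  -A ^ 2 * a₁ ^ 3 * b₁ ^ 3 - 2 * A * a₁ ^ 3 * b₁ * b₀ ^ 2 - 6 * A * B * a₁ ^ 3 * b₁ + A ^ 2 *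
    a₁ ^ 3 * b₀ - 2 * A * a₁ ^ 2 * a₀ * b₁ ^ 2 * b₀ + 5 * A ^ 2 * a₁ ^ 2 * a₀ * b₁ - 3 * a₁ ^
    2 * a₀ * b₀ ^ 3 - 9 * B * a₁ ^ 2 * a₀ * b₀ + 6 * A * B * a₁ ^ 2 * b₁ ^ 2 + 9 * B * a₁ ^
    2 * b₀ ^ 2 + (2 * A ^ 3 + 27 * B ^ 2) * a₁ ^ 2 - 2 * A * a₁ * a₀ ^ 2 * b₁ ^ 3 - 3 * a₁ *
    a₀ ^ 2 * b₁ * b₀ ^ 2 + 9 * B * a₁ * a₀ ^ 2 * b₁ + 9 * A * a₁ * a₀ ^ 2 * b₀ + 36 * B * a₁ *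
    a₀ * b₁ * b₀ - 12 * A * a₁ * a₀ * b₀ ^ 2 - 18 * A * B * a₁ * a₀ - 6 * A * B * a₁ * b₁ ^
    3 + 5 * A ^ 2 * a₁ * b₁ ^ 2 * b₀ + 9 * B * a₁ * b₁ * b₀ ^ 2 + (4 * A ^ 3 - 27 * B ^ 2) *
    a₁ * b₁ - 3 * A * a₁ * b₀ ^ 3 + 36 * A * B * a₁ * b₀ - 3 * a₀ ^ 3 * b₁ ^ 2 * b₀ - 3 * A *
    a₀ ^ 3 * b₁ + 9 * B * a₀ ^ 2 * b₁ ^ 2 - 12 * A * a₀ ^ 2 * b₁ * b₀ + 6 * A ^ 2 * a₀ ^ 2 +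
    A ^ 2 * a₀ * b₁ ^ 3 - 9 * B * a₀ * b₁ ^ 2 * b₀ + 9 * A * a₀ * b₁ * b₀ ^ 2 + 36 * A * B *
    a₀ * b₁ - 24 * A ^ 2 * a₀ * b₀ + (2 * A ^ 3 + 27 * B ^ 2) * b₁ ^ 2 - 18 * A * B * b₁ *
    b₀ + 6 * A ^ 2 * b₀ ^ 2

def sA1 (A B a₁ a₀ b₁ b₀ : F) : F :=
  -A ^ 2 * a₁ ^ 3 * b₁ ^ 2 * b₀ - 4 * B * a₁ ^ 3 * b₁ * b₀ ^ 2 + (A ^ 3 - 12 * B ^ 2) * a₁ ^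
    3 * b₁ + 8 * A * B * a₁ ^ 3 * b₀ - A ^ 2 * a₁ ^ 2 * a₀ * b₁ ^ 3 - 4 * B * a₁ ^ 2 * a₀ *
    b₁ ^ 2 * b₀ + 16 * A * B * a₁ ^ 2 * a₀ * b₁ - 3 * A ^ 2 * a₁ ^ 2 * a₀ * b₀ + (-3 * A ^ 3 +
    12 * B ^ 2) * a₁ ^ 2 * b₁ ^ 2 - 24 * A * B * a₁ ^ 2 * b₁ * b₀ + 3 * A ^ 2 * a₁ ^ 2 * b₀ ^
    2 - 2 * A ^ 2 * B * a₁ ^ 2 - 4 * B * a₁ * a₀ ^ 2 * b₁ ^ 3 - 3 * A ^ 2 * a₁ * a₀ ^ 2 * b₁ -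
    3 * a₁ * a₀ ^ 2 * b₀ ^ 3 + 15 * B * a₁ * a₀ ^ 2 * b₀ - 24 * A * B * a₁ * a₀ * b₁ ^ 2 +
    12 * A ^ 2 * a₁ * a₀ * b₁ * b₀ - 6 * B * a₁ * a₀ * b₀ ^ 2 - 18 * B ^ 2 * a₁ * a₀ + (A ^
    3 - 12 * B ^ 2) * a₁ * b₁ ^ 3 + 16 * A * B * a₁ * b₁ ^ 2 * b₀ - 3 * A ^ 2 * a₁ * b₁ * b₀ ^
    2 + 14 * A ^ 2 * B * a₁ * b₁ - 3 * B * a₁ * b₀ ^ 3 + 63 * B ^ 2 * a₁ * b₀ - 3 * a₀ ^ 3 *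
    b₁ * b₀ ^ 2 - 3 * B * a₀ ^ 3 * b₁ - 3 * A * a₀ ^ 3 * b₀ + 3 * A ^ 2 * a₀ ^ 2 * b₁ ^ 2 -
    6 * B * a₀ ^ 2 * b₁ * b₀ + 9 * A * a₀ ^ 2 * b₀ ^ 2 + 6 * A * B * a₀ ^ 2 + 8 * A * B * a₀ *
    b₁ ^ 3 - 3 * A ^ 2 * a₀ * b₁ ^ 2 * b₀ + 15 * B * a₀ * b₁ * b₀ ^ 2 + 63 * B ^ 2 * a₀ * b₁ -
    3 * A * a₀ * b₀ ^ 3 - 42 * A * B * a₀ * b₀ - 2 * A ^ 2 * B * b₁ ^ 2 - 18 * B ^ 2 * b₁ *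
    b₀ + 6 * A * B * b₀ ^ 2 + 4 * A ^ 4 + 27 * A * B ^ 2

def sA0 (A B a₁ a₀ b₁ b₀ : F) : F :=
  2 * A ^ 2 * B * a₁ ^ 3 * b₁ - A ^ 3 * a₁ ^ 3 * b₀ - A ^ 2 * a₁ ^ 2 * a₀ * b₁ ^ 2 * b₀ - 4 *
    B * a₁ ^ 2 * a₀ * b₁ * b₀ ^ 2 + 12 * B ^ 2 * a₁ ^ 2 * a₀ * b₁ - 4 * A * B * a₁ ^ 2 * a₀ *
    b₀ - 5 * A ^ 2 * B * a₁ ^ 2 * b₁ ^ 2 + (A ^ 3 - 24 * B ^ 2) * a₁ ^ 2 * b₁ * b₀ + 6 * A *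
    B * a₁ ^ 2 * b₀ ^ 2 + (A ^ 4 + 6 * A * B ^ 2) * a₁ ^ 2 - 4 * B * a₁ * a₀ ^ 2 * b₁ ^ 2 *
    b₀ + 2 * A * a₁ * a₀ ^ 2 * b₁ * b₀ ^ 2 - 2 * A * B * a₁ * a₀ ^ 2 * b₁ - A ^ 2 * a₁ * a₀ ^
    2 * b₀ + (A ^ 3 - 24 * B ^ 2) * a₁ * a₀ * b₁ ^ 2 + 24 * A * B * a₁ * a₀ * b₁ * b₀ - 3 *
    A ^ 2 * a₁ * a₀ * b₀ ^ 2 + A ^ 2 * B * a₁ * a₀ + 2 * A ^ 2 * B * a₁ * b₁ ^ 3 + 12 * B ^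
    2 * a₁ * b₁ ^ 2 * b₀ - 2 * A * B * a₁ * b₁ * b₀ ^ 2 + (-2 * A ^ 4 - 6 * A * B ^ 2) * a₁ *
    b₁ - 5 * A ^ 2 * B * a₁ * b₀ - a₀ ^ 3 * b₀ ^ 3 - 3 * B * a₀ ^ 3 * b₀ + 6 * A * B * a₀ ^
    2 * b₁ ^ 2 - 3 * A ^ 2 * a₀ ^ 2 * b₁ * b₀ + 3 * B * a₀ ^ 2 * b₀ ^ 2 + (A ^ 3 + 9 * B ^
    2) * a₀ ^ 2 - A ^ 3 * a₀ * b₁ ^ 3 - 4 * A * B * a₀ * b₁ ^ 2 * b₀ - A ^ 2 * a₀ * b₁ * b₀ ^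
    2 - 5 * A ^ 2 * B * a₀ * b₁ - 3 * B * a₀ * b₀ ^ 3 + (2 * A ^ 3 - 9 * B ^ 2) * a₀ * b₀ +
    (A ^ 4 + 6 * A * B ^ 2) * b₁ ^ 2 + A ^ 2 * B * b₁ * b₀ + (A ^ 3 + 9 * B ^ 2) * b₀ ^ 2 +
    4 * A ^ 3 * B + 27 * B ^ 3

def sB3 (A B a₁ a₀ b₁ b₀ : F) : F :=
  a₁ ^ 3 * b₀ ^ 2 - B * a₁ ^ 3 - 2 * a₁ ^ 2 * a₀ * b₁ * b₀ + A * a₁ ^ 2 * a₀ + a₁ ^ 2 * b₁ *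
    b₀ ^ 2 - 3 * B * a₁ ^ 2 * b₁ + A * a₁ ^ 2 * b₀ + a₁ * a₀ ^ 2 * b₁ ^ 2 - 2 * a₁ * a₀ * b₁ ^
    2 * b₀ + 2 * A * a₁ * a₀ * b₁ - 3 * B * a₁ * b₁ ^ 2 + 2 * A * a₁ * b₁ * b₀ + a₀ ^ 3 + a₀ ^
    2 * b₁ ^ 3 + 3 * a₀ ^ 2 * b₀ + A * a₀ * b₁ ^ 2 + 3 * a₀ * b₀ ^ 2 - B * b₁ ^ 3 + A * b₁ ^
    2 * b₀ + b₀ ^ 3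

def sB2 (A B a₁ a₀ b₁ b₀ : F) : F :=
  A ^ 2 * a₁ ^ 3 + 3 * a₁ ^ 2 * a₀ * b₀ ^ 2 + 9 * B * a₁ ^ 2 * a₀ + 3 * A ^ 2 * a₁ ^ 2 * b₁ +
    3 * a₁ ^ 2 * b₀ ^ 3 + 9 * B * a₁ ^ 2 * b₀ - 6 * a₁ * a₀ ^ 2 * b₁ * b₀ - 3 * A * a₁ * a₀ ^
    2 - 6 * a₁ * a₀ * b₁ * b₀ ^ 2 + 18 * B * a₁ * a₀ * b₁ - 6 * A * a₁ * a₀ * b₀ + 3 * A ^ 2 *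
    a₁ * b₁ ^ 2 + 18 * B * a₁ * b₁ * b₀ - 3 * A * a₁ * b₀ ^ 2 + 3 * a₀ ^ 3 * b₁ ^ 2 + 3 * a₀ ^
    2 * b₁ ^ 2 * b₀ - 3 * A * a₀ ^ 2 * b₁ + 9 * B * a₀ * b₁ ^ 2 - 6 * A * a₀ * b₁ * b₀ + A ^
    2 * b₁ ^ 3 + 9 * B * b₁ ^ 2 * b₀ - 3 * A * b₁ * b₀ ^ 2

def sB1 (A B a₁ a₀ b₁ b₀ : F) : F :=
  -A ^ 2 * a₁ ^ 3 * b₁ ^ 2 - 2 * A * a₁ ^ 3 * b₀ ^ 2 + 2 * A * B * a₁ ^ 3 - 12 * B * a₁ ^ 2 *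
    a₀ * b₁ ^ 2 + 4 * A * a₁ ^ 2 * a₀ * b₁ * b₀ - 3 * A ^ 2 * a₁ ^ 2 * a₀ - A ^ 2 * a₁ ^ 2 *
    b₁ ^ 3 - 12 * B * a₁ ^ 2 * b₁ ^ 2 * b₀ + 4 * A * a₁ ^ 2 * b₁ * b₀ ^ 2 + A ^ 2 * a₁ ^ 2 *
    b₀ + 4 * A * a₁ * a₀ ^ 2 * b₁ ^ 2 - 3 * a₁ * a₀ ^ 2 * b₀ ^ 2 - 9 * B * a₁ * a₀ ^ 2 + 4 *
    A * a₁ * a₀ * b₁ ^ 2 * b₀ + 2 * A ^ 2 * a₁ * a₀ * b₁ + 6 * a₁ * a₀ * b₀ ^ 3 + 18 * B *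
    a₁ * a₀ * b₀ + 2 * A ^ 2 * a₁ * b₁ * b₀ + 9 * B * a₁ * b₀ ^ 2 + (4 * A ^ 3 + 27 * B ^ 2) *
    a₁ + 6 * a₀ ^ 3 * b₁ * b₀ + A * a₀ ^ 3 - 2 * A * a₀ ^ 2 * b₁ ^ 3 - 3 * a₀ ^ 2 * b₁ * b₀ ^
    2 + 9 * B * a₀ ^ 2 * b₁ - 9 * A * a₀ ^ 2 * b₀ + A ^ 2 * a₀ * b₁ ^ 2 + 18 * B * a₀ * b₁ *
    b₀ - 9 * A * a₀ * b₀ ^ 2 + 2 * A * B * b₁ ^ 3 - 3 * A ^ 2 * b₁ ^ 2 * b₀ - 9 * B * b₁ *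
    b₀ ^ 2 + (4 * A ^ 3 + 27 * B ^ 2) * b₁ + A * b₀ ^ 3

def sB0 (A B a₁ a₀ b₁ b₀ : F) : F :=
  -2 * A ^ 2 * a₁ ^ 3 * b₁ * b₀ - 8 * B * a₁ ^ 3 * b₀ ^ 2 + (A ^ 3 + 8 * B ^ 2) * a₁ ^ 3 + A ^
    2 * a₁ ^ 2 * a₀ * b₁ ^ 2 - 8 * B * a₁ ^ 2 * a₀ * b₁ * b₀ + 6 * A * a₁ ^ 2 * a₀ * b₀ ^ 2 -
    2 * A * B * a₁ ^ 2 * a₀ + A ^ 2 * a₁ ^ 2 * b₁ ^ 2 * b₀ + 4 * B * a₁ ^ 2 * b₁ * b₀ ^ 2 +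
    (-A ^ 3 - 12 * B ^ 2) * a₁ ^ 2 * b₁ + 4 * A * B * a₁ ^ 2 * b₀ + 4 * B * a₁ * a₀ ^ 2 * b₁ ^
    2 + A ^ 2 * a₁ * a₀ ^ 2 - 2 * A ^ 2 * a₁ * a₀ * b₁ ^ 3 - 8 * B * a₁ * a₀ * b₁ ^ 2 * b₀ +
    8 * A * B * a₁ * a₀ * b₁ - 6 * A ^ 2 * a₁ * a₀ * b₀ + (-A ^ 3 - 12 * B ^ 2) * a₁ * b₁ ^
    2 + 8 * A * B * a₁ * b₁ * b₀ - 3 * A ^ 2 * a₁ * b₀ ^ 2 + 3 * a₀ ^ 3 * b₀ ^ 2 + B * a₀ ^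
    3 - 8 * B * a₀ ^ 2 * b₁ ^ 3 + 6 * A * a₀ ^ 2 * b₁ ^ 2 * b₀ - 3 * A ^ 2 * a₀ ^ 2 * b₁ + 3 *
    a₀ ^ 2 * b₀ ^ 3 - 15 * B * a₀ ^ 2 * b₀ + 4 * A * B * a₀ * b₁ ^ 2 - 6 * A ^ 2 * a₀ * b₁ *
    b₀ - 15 * B * a₀ * b₀ ^ 2 + (4 * A ^ 3 + 27 * B ^ 2) * a₀ + (A ^ 3 + 8 * B ^ 2) * b₁ ^ 3 -
    2 * A * B * b₁ ^ 2 * b₀ + A ^ 2 * b₁ * b₀ ^ 2 + B * b₀ ^ 3 + (4 * A ^ 3 + 27 * B ^ 2) *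
    b₀

open Classical in
/-- The factor by which the explicit formulas are multiplied to make the second component of
`S_{Q,R}` monic (of degree three), if `b₃ ≠ 0`. (If `b₃ = 0`, then no scaling is done.) -/
def sScale (A B : F) (L L' : Line F) : F :=
  if sB3 A B L.a₁ L.a₀ L'.a₁ L'.a₀ = 0 then 1 else (sB3 A B L.a₁ L.a₀ L'.a₁ L'.a₀)⁻¹

/-- The pair `(S₁, S₂)` with `S_{Q,R} = S₁ + y S₂`, computed from the lines of `Q` and `R`. -/
def sPoly (A B : F) (L L' : Line F) : F[X] × F[X] :=
  (C (sScale A B L L') *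
      (C (sA4 A B L.a₁ L.a₀ L'.a₁ L'.a₀) * X ^ 4 + C (sA3 A B L.a₁ L.a₀ L'.a₁ L'.a₀) * X ^ 3 +
        C (sA2 A B L.a₁ L.a₀ L'.a₁ L'.a₀) * X ^ 2 + C (sA1 A B L.a₁ L.a₀ L'.a₁ L'.a₀) * X +
        C (sA0 A B L.a₁ L.a₀ L'.a₁ L'.a₀)),
    C (sScale A B L L') *
      (C (sB3 A B L.a₁ L.a₀ L'.a₁ L'.a₀) * X ^ 3 + C (sB2 A B L.a₁ L.a₀ L'.a₁ L'.a₀) * X ^ 2 +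
        C (sB1 A B L.a₁ L.a₀ L'.a₁ L'.a₀) * X + C (sB0 A B L.a₁ L.a₀ L'.a₁ L'.a₀)))

end Formulas

section Subalgorithm

variable {F : Type*} [Field F]

/-- `(g₁, g₀) = (L.a₁, L.a₀)` solves the linear system with the augmented matrix `L(W, S)`, where
`W = x³ + w₂x² + w₁x + w₀` and `S = (a₄x⁴ + … + a₀) + y (x³ + b₂x² + b₁x + b₀)`. -/
def SolvesSystem (W : F[X]) (S : F[X] × F[X]) (L : Line F) : Prop :=
  let w := W.coeff
  let a := S.1.coeff
  let b := S.2.coeff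
  w 0 * (w 2 - b 2) * L.a₁ + (b 0 - w 0) * L.a₀ = w 0 * a 3 - a 4 * w 2 * w 0 - a 0 ∧
  w 0 * (w 1 - b 1) * L.a₁ + (b 0 * w 2 - w 0 * b 2) * L.a₀ =
    w 0 * a 2 - a 4 * w 1 * w 0 - a 0 * w 2 ∧
  w 0 * (w 0 - b 0) * L.a₁ + (b 0 * w 1 - b 1 * w 0) * L.a₀ =
    w 0 * a 1 - a 4 * w 0 ^ 2 - a 0 * w 1

open Classical in
/-- The solution of the linear system `L(W, S)`. It fails if there is no solution, or if there are
several. -/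
def solveSystem (W : F[X]) (S : F[X] × F[X]) : Option (Line F) :=
  if h : ∃! L : Line F, SolvesSystem W S L then some h.choose else none

/-- The monic scalar multiple of a nonzero polynomial. -/
def toMonic (g : F[X]) : F[X] := C g.leadingCoeff⁻¹ * g

/-- `f S₂² - S₁²` for `S = S₁ + y S₂`. -/
def sigma (A B : F) (S : F[X] × F[X]) : F[X] := cubic A B * S.2 ^ 2 - S.1 ^ 2

open Classical in
/-- The distinct monic irreducible factors of degree three of `G`. -/
def cubicFactors (G : F[X]) : Finset F[X] :=
  (UniqueFactorizationMonoid.normalizedFactors G).toFinset.filter fun W => W.natDegree = 3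

open Classical in
/-- The final loop of the subalgorithm, over a list of polynomials `W`. -/
def factorLoop (S T : F[X] × F[X]) : List F[X] → Option (Line F)
  | [] => none
  | W :: Ws =>
    if W ≠ S.2 then
      match solveSystem W S with
      | none => none
      | some L =>
        if W ∣ (C L.a₁ * X + C L.a₀) * T.2 + T.1 then some L else factorLoop S T Ws
    else solveSystem W T

open Classical in
/-- Subalgorithm 1, with input the lines of `m₁P`, `m₂P`, `n₁P`, `n₂P`. The function `enum`
lists the elements of a finite set of polynomials in some order: it fixes the order in which the
final loop runs through the factors. The value `none` means that the algorithm fails. -/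
def subalg (enum : Finset F[X] → List F[X]) (A B : F) (M₁ M₂ N₁ N₂ : Line F) : Option (Line F) :=
  if M₁ = M₂ then some M₁.neg
  else if N₁ = N₂ then some N₁.neg
  else
    let S := sPoly A B M₁ M₂
    let T := sPoly A B N₁ N₂
    if M₁ = M₂.neg then solveSystem (toMonic S.1) T
    else if N₁ = N₂.neg then solveSystem (toMonic T.1) S
    else factorLoop S T (enum (cubicFactors (EuclideanDomain.gcd (sigma A B S) (sigma A B T))))

/-- Doubling, where the failure of an earlier computation is propagated. -/
def D (A B : F) (x : Option (Line F)) : Option (Line F) := x.bind (dbl A B)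

/-- Subalgorithm 1, where the failure of an earlier computation is propagated. -/
def Subalg (enum : Finset F[X] → List F[X]) (A B : F) (x₁ x₂ x₃ x₄ : Option (Line F)) :
    Option (Line F) :=
  x₁.bind fun L₁ => x₂.bind fun L₂ => x₃.bind fun L₃ => x₄.bind fun L₄ =>
    subalg enum A B L₁ L₂ L₃ L₄

end Subalgorithm

section Ladder

/-- The set `M` of exceptional residues modulo `p`. -/
def exceptional (p : ℕ) [Fact p.Prime] (s : ZMod p) : Set (ZMod p) :=
  {3 / (2 * s + 1), -3 / (2 * s + 1), (s - 4) / (3 * s), (4 * s - 1) / (2 * s + 1),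
    (s + 5) / (3 * (s + 1)), (4 * s + 5) / (2 * s + 1)}

/-- The set `ℳ` of the odd integers in `[0, p)` whose residue modulo `p` lies in `M`. -/
def oddExceptional (p : ℕ) [Fact p.Prime] (s : ZMod p) : Set ℕ :=
  {k | Odd k ∧ k < p ∧ (k : ZMod p) ∈ exceptional p s}

/-- The binary prefix `k_i = ∑_{j ≥ i} m_j 2^{j-i}` of `m = ∑_j m_j 2^j`. -/
def binPrefix (m i : ℕ) : ℕ := m / 2 ^ i

variable {F : Type*} [Field F] [Fintype F] {K : Type*} [Field K] [DecidableEq K] [Algebra F K]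
  {A B : F}

open Classical in
/-- The pair `(u_i, v_i)`, for `0 ≤ i < ℓ`, where `ℓ = m.size` is the number of binary digits of
`m`, and `m.testBit i` is the digit `m_i`. (For `i ≥ ℓ` nothing is computed.) -/
def ladder (enum : Finset F[X] → List F[X]) (P : Points K A B) (p : ℕ) [Fact p.Prime] (s : ZMod p)
    (m : ℕ) (i : ℕ) : Option (Line F) × Option (Line F) :=
  let h : ℤ → Option (Line F) := fun n => lineOf (n • P)
  if m.size ≤ i then (none, none)
  else if i + 1 = m.size then (h 1, h 2)
  else if i + 2 = m.size then
    if m.testBit i then (h 3, h 4) else (h 2, h 3)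
  else
    let u₁ := (ladder enum P p s m (i + 1)).1
    let v₁ := (ladder enum P p s m (i + 1)).2
    let u₂ := (ladder enum P p s m (i + 2)).1
    let v₂ := (ladder enum P p s m (i + 2)).2
    let u₃ := (ladder enum P p s m (i + 3)).1
    let v₃ := (ladder enum P p s m (i + 3)).2
    let w : Option (Line F) :=
      if binPrefix m i ∈ oddExceptional p s ∨ binPrefix m i + 1 ∈ oddExceptional p s then
        match m.testBit (i + 1), m.testBit (i + 2) with
        | true, true => Subalg enum A B (h 3) (D A B (D A B u₂)) (h 7) (D A B (D A B (D A B u₃)))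
        | true, false =>
          Subalg enum A B (h 3) (D A B (D A B (D A B u₃))) (h (-5)) (D A B (D A B (D A B v₃)))
        | false, true =>
          Subalg enum A B (h (-3)) (D A B (D A B (D A B v₃))) (h 5) (D A B (D A B (D A B u₃)))
        | false, false =>
          Subalg enum A B (h (-3)) (D A B (D A B v₂)) (h (-7)) (D A B (D A B (D A B v₃)))
      else Subalg enum A B (h 1) (D A B u₁) u₁ v₁
    if m.testBit i then (w, D A B v₁) else (D A B u₁, w)
termination_by m.size - i

end Ladder

end

end T3

/-!
Let `φ(P) = s P`, so that `s ^ 2 + s + 1 = 0` in `ℤ/p`. The function `S_{Q,R}` with `Q = a P` and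
`R = b P` vanishes exactly at the nine points `c P` where `c` is a sum of a conjugate `s ^ i a` of
`a` and a conjugate `s ^ j b` of `b`; up to conjugation these are three points. The subalgorithm
looks for a common zero of `S_{a,b}` and `S_{c,d}` where `a + b = c + d`, and it finds the line of
`a + b` as soon as the two sets of conjugate sums have no other element in common. Any other
coincidence is a linear equation between conjugates with small coefficients. For the parameters of
the special case the equation says that `p` divides a nonzero Eisenstein integer of norm at most
`3303`, which is impossible; for those of the general case it says that `k` or `k + 1` is an
exceptional residue.
-/

namespace T3

section Identities

variable {F : Type*} [Field F]

/-- The line `y = l x + n` meets the curve `y² = x³ + A x + B` in three points with abscissas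
`r₁`, `r₂`, `r₃`, counted with multiplicity: Vieta's formulas for
`x³ + A x + B - (l x + n)² = (x - r₁) (x - r₂) (x - r₃)`. -/
structure IsIntersection (A B l n r₁ r₂ r₃ : F) : Prop where
  sum_eq : r₁ + r₂ + r₃ = l ^ 2
  sum_mul_eq : r₁ * r₂ + r₁ * r₃ + r₂ * r₃ = A - 2 * l * n
  prod_eq : r₁ * r₂ * r₃ = n ^ 2 - B

theorem cubic_sub_sq_eq_toPoly (A B l n : F) : cubic A B - (C l * X + C n) ^ 2 =
    (⟨1, -l ^ 2, A - 2 * l * n, B - n ^ 2⟩ : Cubic F).toPoly := by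
  simp only [Cubic.toPoly, cubic, C_neg, C_sub, C_mul, C_pow, C_1, C_ofNat]
  ring

theorem monic_cubic_sub_sq (A B l n : F) : (cubic A B - (C l * X + C n) ^ 2).Monic := by
  rw [cubic_sub_sq_eq_toPoly]
  exact Cubic.monic_of_a_eq_one'

theorem natDegree_cubic_sub_sq (A B l n : F) :
    (cubic A B - (C l * X + C n) ^ 2).natDegree = 3 := by
  rw [cubic_sub_sq_eq_toPoly]
  exact Cubic.natDegree_of_a_ne_zero' one_ne_zero

namespace IsIntersection

variable {A B l n r₁ r₂ r₃ : F}

theorem of_cubic_sub_eq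
    (h : cubic A B - (C l * X + C n) ^ 2 = (X - C r₁) * (X - C r₂) * (X - C r₃)) :
    IsIntersection A B l n r₁ r₂ r₃ := by
  rw [cubic_sub_sq_eq_toPoly, Cubic.prod_X_sub_C_eq, Cubic.toPoly_injective, Cubic.mk.injEq] at h
  obtain ⟨-, hsum, hpairs, hprod⟩ := h
  exact ⟨neg_injective hsum.symm, hpairs.symm, by linear_combination hprod⟩

theorem eq_A (h : IsIntersection A B l n r₁ r₂ r₃) :
    A = r₁ * r₂ + r₁ * r₃ + r₂ * r₃ + 2 * l * n := by
  linear_combination -h.sum_mul_eq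

theorem eq_B (h : IsIntersection A B l n r₁ r₂ r₃) : B = n ^ 2 - r₁ * r₂ * r₃ := by
  linear_combination h.prod_eq

end IsIntersection

/-- The value at `(x, y)` of the polynomial `S_{Q,R}`, before scaling, for the lines
`y = a x + a₀` of `Q` and `y = b x + b₀` of `R`. -/
def sVal (A B a a₀ b b₀ x y : F) : F :=
  sA4 A B a a₀ b b₀ * x ^ 4 + sA3 A B a a₀ b b₀ * x ^ 3 + sA2 A B a a₀ b b₀ * x ^ 2 +
      sA1 A B a a₀ b b₀ * x + sA0 A B a a₀ b b₀ +
    y * (sB3 A B a a₀ b b₀ * x ^ 3 + sB2 A B a a₀ b b₀ * x ^ 2 + sB1 A B a a₀ b b₀ * x +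
      sB0 A B a a₀ b b₀)

/-- An elimination matrix for `S_{Q,R}`. Let the chord of slope `l` through `Q` and `R` meet the
curve again at `(x, y)`, and let `u` and `v` be the abscissas of `Q` and `R` relative to `x`. With
`g = 3 x` and `d = f'(x)`, the curve gives `l² = g + u + v` and `u v = d - 2 y l`; the two lines, of
slopes `a`, `b` and heights `e`, `e'` above `(x, y)`, give `l u = e + a u` and `l v = e' + b v`.
These relations make the span of `1, l, u, v` stable under `l` and `u`, and the rows below are the
coordinates of `(l v) u = l (u v)`, of `(l u) v = l (u v)`, and of the first relation multiplied by
`l` and by `u`. -/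
def secantMatrix (g y d a e b e' : F) : Matrix (Fin 4) (Fin 4) F :=
  !![-2 * y * g - b * d, d + 2 * b * y, -2 * y - e', -2 * y;
    -2 * y * g - a * d, d + 2 * a * y, -2 * y, -2 * y - e;
    d * g + 2 * b * y * g - 2 * y * (e + e') - e * e', -2 * y * g - b * d,
      d + 2 * (b - a) * y - a * e', d;
    (d + 2 * b * y) * e - 2 * y * d - (2 * y + e') * (a * e - d),
      4 * y ^ 2 - (2 * y + e') * (e + 2 * y),
      (a - b) * d + 2 * y * (a * b - g) - (2 * y + e') * (a ^ 2 - g), 0]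

theorem secantMatrix_mulVec {g y d a e b e' l u v : F} (hg : g = l ^ 2 - u - v)
    (hd : d = 2 * y * l + u * v) (he : e = (l - a) * u) (he' : e' = (l - b) * v) :
    (secantMatrix g y d a e b e').mulVec ![1, l, u, v] = 0 := by
  subst hg hd he he'
  ext i
  fin_cases i <;> simp [secantMatrix, Matrix.mulVec, dotProduct, Fin.sum_univ_four] <;> ring

theorem sVal_neg_eq_det_secantMatrix {A B a a₀ b b₀ x y d e e' : F} (hA : A = d - 3 * x ^ 2)
    (hB : B = y ^ 2 - d * x + 2 * x ^ 3) (ha₀ : a₀ = e + y - a * x) (hb₀ : b₀ = e' + y - b * x) :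
    sVal A B a a₀ b b₀ x (-y) = -(secantMatrix (3 * x) y d a e b e').det := by
  subst hA hB ha₀ hb₀
  rw [Matrix.det_succ_row_zero]
  simp [secantMatrix, Fin.sum_univ_four, Matrix.det_fin_three,
    Fin.succAbove, sVal, sA4, sA3, sA2, sA1, sA0, sB3, sB2, sB1, sB0]
  ring

theorem sVal_eq_zero_of_chord {A B a a₀ b b₀ l n x₁ x₂ x₃ : F}
    (h : IsIntersection A B l n x₁ x₂ x₃) (ha : a * x₁ + a₀ = l * x₁ + n)
    (hb : b * x₂ + b₀ = l * x₂ + n) : sVal A B a a₀ b b₀ x₃ (-(l * x₃ + n)) = 0 := by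
  rw [sVal_neg_eq_det_secantMatrix (d := A + 3 * x₃ ^ 2) (e := (l - a) * (x₁ - x₃))
    (e' := (l - b) * (x₂ - x₃)) (by ring)
    (by linear_combination h.prod_eq - x₃ * h.sum_mul_eq + x₃ ^ 2 * h.sum_eq)
    (by linear_combination ha) (by linear_combination hb), neg_eq_zero,
    ← Matrix.exists_mulVec_eq_zero_iff]
  refine ⟨![1, l, x₁ - x₃, x₂ - x₃], fun h0 => one_ne_zero (congrFun h0 0),
    secantMatrix_mulVec ?_ ?_ rfl rfl⟩
  · linear_combination h.sum_eq
  · linear_combination 2 * x₃ * h.sum_eq - h.sum_mul_eq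

theorem dbl_eval_of_tangent {A B a a₀ l n x₁ x₃ : F} (h : IsIntersection A B l n x₁ x₁ x₃)
    (ha : a * x₁ + a₀ = l * x₁ + n) :
    dblC A B a a₀ * -(l * x₃ + n) = dblU1 A B a a₀ * x₃ + dblU0 A B a a₀ := by
  obtain rfl : a₀ = (l - a) * x₁ + n := by linear_combination ha
  obtain rfl : x₃ = l ^ 2 - x₁ - x₁ := by linear_combination h.sum_eq
  obtain ⟨rfl, rfl⟩ := And.intro h.eq_A h.eq_B
  simp only [dblC, dblU1, dblU0]
  ring

theorem dblC_eq_prod {A B a a₀ r₁ r₂ r₃ : F} (h : IsIntersection A B a a₀ r₁ r₂ r₃) :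
    dblC A B a a₀ = -8 * ((a * r₁ + a₀) * (a * r₂ + a₀) * (a * r₃ + a₀)) := by
  obtain ⟨rfl, rfl⟩ := And.intro h.eq_A h.eq_B
  simp only [dblC]
  linear_combination (8 * a * a₀ ^ 2) * h.sum_eq

theorem sB3_eq_prod {A B a a₀ r₁ r₂ r₃ : F} (h : IsIntersection A B a a₀ r₁ r₂ r₃) (b b₀ : F) :
    sB3 A B a a₀ b b₀ = ((a + b) * r₁ + (a₀ + b₀)) * ((a + b) * r₂ + (a₀ + b₀)) *
      ((a + b) * r₃ + (a₀ + b₀)) := by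
  obtain ⟨rfl, rfl⟩ := And.intro h.eq_A h.eq_B
  simp only [sB3]
  linear_combination (-(a + b) * (a₀ + b₀) ^ 2) * h.sum_eq

theorem sA4_neg (A B a a₀ : F) : sA4 A B a a₀ (-a) (-a₀) = 0 := by simp only [sA4]; ring
theorem sB3_neg (A B a a₀ : F) : sB3 A B a a₀ (-a) (-a₀) = 0 := by simp only [sB3]; ring
theorem sB2_neg (A B a a₀ : F) : sB2 A B a a₀ (-a) (-a₀) = 0 := by simp only [sB2]; ring
theorem sB1_neg (A B a a₀ : F) : sB1 A B a a₀ (-a) (-a₀) = 0 := by simp only [sB1]; ring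
theorem sB0_neg (A B a a₀ : F) : sB0 A B a a₀ (-a) (-a₀) = 0 := by simp only [sB0]; ring

/-- Both sides are minus the discriminant of `f - (a x + a₀)²`. -/
theorem sA3_neg_eq {A B a a₀ r₁ r₂ r₃ : F} (h : IsIntersection A B a a₀ r₁ r₂ r₃) :
    sA3 A B a a₀ (-a) (-a₀) = -((r₁ - r₂) * (r₁ - r₃) * (r₂ - r₃)) ^ 2 := by
  have discr_eq : ((r₁ - r₂) * (r₁ - r₃) * (r₂ - r₃)) ^ 2 =
      (r₁ + r₂ + r₃) ^ 2 * (r₁ * r₂ + r₁ * r₃ + r₂ * r₃) ^ 2 -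
        4 * (r₁ * r₂ + r₁ * r₃ + r₂ * r₃) ^ 3 - 4 * (r₁ + r₂ + r₃) ^ 3 * (r₁ * r₂ * r₃) -
        27 * (r₁ * r₂ * r₃) ^ 2 +
        18 * (r₁ + r₂ + r₃) * (r₁ * r₂ + r₁ * r₃ + r₂ * r₃) * (r₁ * r₂ * r₃) := by
    ring
  rw [discr_eq, h.sum_eq, h.sum_mul_eq, h.prod_eq]
  simp only [sA3]
  ring

end Identities

section Coordinates

open WeierstrassCurve.Affine

variable {F : Type*} [Field F] {K : Type*} [Field K] [Algebra F K] {A B : F}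

/-- The abscissa of an affine point. The point at infinity gets the junk value `0`. -/
def xCoord : Points K A B → K
  | .zero => 0
  | .some x _ _ => x

/-- The ordinate of an affine point. The point at infinity gets the junk value `0`. -/
def yCoord : Points K A B → K
  | .zero => 0
  | .some _ y _ => y

theorem exists_eq_some {Z : Points K A B} (hZ : Z ≠ 0) :
    ∃ h, Z = .some (xCoord Z) (yCoord Z) h := by
  rcases Z with _ | ⟨x, y, h⟩
  · exact absurd rfl hZ
  · exact ⟨h, rfl⟩

theorem yCoord_sq {Z : Points K A B} (hZ : Z ≠ 0) : yCoord Z ^ 2 =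
    xCoord Z ^ 3 + algebraMap F K A * xCoord Z + algebraMap F K B := by
  obtain ⟨h, -⟩ := exists_eq_some hZ
  simpa [curve, WeierstrassCurve.Affine.equation_iff] using h.1

@[simp]
theorem xCoord_neg (Z : Points K A B) : xCoord (-Z) = xCoord Z := by
  rcases Z with _ | _ <;> rfl

theorem negY_eq_neg (x y : K) : ((curve A B).baseChange K).toAffine.negY x y = -y := by
  simp [negY, curve]

@[simp]
theorem yCoord_neg (Z : Points K A B) : yCoord (-Z) = -yCoord Z := by
  rcases Z with _ | ⟨x, y, -⟩
  · exact neg_zero.symm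
  · exact negY_eq_neg x y

theorem ext_coord {Z Z' : Points K A B} (hZ : Z ≠ 0) (hZ' : Z' ≠ 0) (hx : xCoord Z = xCoord Z')
    (hy : yCoord Z = yCoord Z') : Z = Z' := by
  obtain ⟨h, e⟩ := exists_eq_some hZ
  obtain ⟨h', e'⟩ := exists_eq_some hZ'
  rw [e, e', Point.some.injEq]
  exact ⟨hx, hy⟩

theorem xCoord_eq_iff {Z Z' : Points K A B} (hZ : Z ≠ 0) (hZ' : Z' ≠ 0) :
    xCoord Z = xCoord Z' ↔ Z = Z' ∨ Z = -Z' := by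
  classical
  constructor
  · intro hx
    have hy : yCoord Z ^ 2 = yCoord Z' ^ 2 := by rw [yCoord_sq hZ, yCoord_sq hZ', hx]
    refine (sq_eq_sq_iff_eq_or_eq_neg.1 hy).imp (ext_coord hZ hZ' hx) fun hy => ?_
    exact ext_coord hZ (neg_ne_zero.2 hZ') (by rw [hx, xCoord_neg]) (by rw [hy, yCoord_neg])
  · rintro (rfl | rfl)
    · rfl
    · rw [xCoord_neg]

variable [DecidableEq K]

/-- The line is the chord through `Q` and `R`, or the tangent if `Q = R`. -/
theorem exists_chord {Q R : Points K A B} (hQ : Q ≠ 0) (hR : R ≠ 0) (hQR : Q + R ≠ 0) :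
    ∃ l n : K, yCoord Q = l * xCoord Q + n ∧ yCoord R = l * xCoord R + n ∧
      yCoord (Q + R) = -(l * xCoord (Q + R) + n) ∧
      IsIntersection (algebraMap F K A) (algebraMap F K B) l n (xCoord Q) (xCoord R)
        (xCoord (Q + R)) := by
  rcases Q with _ | ⟨x₁, y₁, h₁⟩
  · exact absurd rfl hQ
  rcases R with _ | ⟨x₂, y₂, h₂⟩
  · exact absurd rfl hR
  have hne : ¬(x₁ = x₂ ∧ y₁ = ((curve A B).baseChange K).toAffine.negY x₂ y₂) :=
    fun h => hQR (Point.add_of_Y_eq h.1 h.2)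
  rw [Point.add_some hne]
  set l := ((curve A B).baseChange K).toAffine.slope x₁ x₂ y₁ y₂ with hl
  refine ⟨l, y₁ - l * x₁, ?_, ?_, ?_, ?_⟩ <;> simp only [xCoord, yCoord]
  · ring
  · by_cases hx : x₁ = x₂
    · obtain rfl := Y_eq_of_Y_ne h₁.1 h₂.1 hx fun h => hne ⟨hx, h⟩
      rw [hx]
      ring
    · have slope_mul : l * (x₁ - x₂) = y₁ - y₂ := by
        rw [hl, slope_of_X_ne hx, div_mul_cancel₀ _ (sub_ne_zero.2 hx)]
      linear_combination slope_mul
  · rw [addY, negY_eq_neg, negAddY]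
    ring
  · have factor := addPolynomial_slope h₁.1 h₂.1 hne
    rw [addPolynomial_eq, neg_inj, Cubic.prod_X_sub_C_eq, Cubic.toPoly_injective,
      Cubic.mk.injEq, ← hl] at factor
    obtain ⟨-, -, hpairs, hprod⟩ := factor
    have ha₁ : ((curve A B).baseChange K).toAffine.a₁ = 0 := map_zero _
    have ha₂ : ((curve A B).baseChange K).toAffine.a₂ = 0 := map_zero _
    have ha₃ : ((curve A B).baseChange K).toAffine.a₃ = 0 := map_zero _
    have ha₄ : ((curve A B).baseChange K).toAffine.a₄ = algebraMap F K A := rfl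
    have ha₆ : ((curve A B).baseChange K).toAffine.a₆ = algebraMap F K B := rfl
    rw [ha₁, ha₃, ha₄] at hpairs
    rw [ha₃, ha₆] at hprod
    refine ⟨?_, by linear_combination -hpairs, by linear_combination hprod⟩
    rw [addX, ha₁, ha₂]
    ring

end Coordinates

section Frobenius

variable {F : Type*} [Field F] {K : Type*} [Field K] [Algebra F K] {A B : F}

theorem isIntegral_of_finrank_eq_three (hK : Module.finrank F K = 3) (x : K) : IsIntegral F x :=
  have : Module.Finite F K := Module.finite_of_finrank_eq_succ hK
  .of_finite F x

variable [Fintype F]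

theorem mem_range_of_pow_card_eq {x : K} (hx : x ^ Fintype.card F = x) :
    ∃ a : F, algebraMap F K a = x := by
  have splits : (X ^ Fintype.card F - X : F[X]).Splits := by
    rw [splits_iff_card_roots, FiniteField.roots_X_pow_card_sub_X, Finset.card_val,
      Finset.card_univ, FiniteField.X_pow_card_sub_X_natDegree_eq F Fintype.one_lt_card]
  refine splits.mem_range_of_isRoot
    (FiniteField.X_pow_card_sub_X_ne_zero F Fintype.one_lt_card) (i := algebraMap F K) ?_
  simp [IsRoot.def, hx]

theorem pow_card_injective : Function.Injective fun x : K => x ^ Fintype.card F :=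
  (FiniteField.frobeniusAlgHom F K).toRingHom.injective

theorem mul_add_pow_card (l x n : K) : (l * x + n) ^ Fintype.card F =
    l ^ Fintype.card F * x ^ Fintype.card F + n ^ Fintype.card F := by
  rw [← mul_pow]
  exact map_add (FiniteField.frobeniusAlgHom F K) _ _

theorem algebraMap_pow_card (a : F) : algebraMap F K a ^ Fintype.card F = algebraMap F K a := by
  rw [← map_pow, FiniteField.pow_card]

theorem pow_card_cube (hK : Module.finrank F K = 3) (x : K) :
    x ^ Fintype.card F ^ 3 = x := by
  have : Module.Finite F K := Module.finite_of_finrank_eq_succ hK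
  have : Finite K := Module.finite_of_finite F
  have := Fintype.ofFinite K
  rw [← hK, ← Module.card_eq_pow_finrank, FiniteField.pow_card]

theorem aeval_pow_card (G : F[X]) (x : K) :
    aeval (x ^ Fintype.card F) G = aeval x G ^ Fintype.card F :=
  aeval_algHom_apply (FiniteField.frobeniusAlgHom F K) x G

theorem pow_card_sq_ne (hK : Module.finrank F K = 3) {x : K} (hx : x ^ Fintype.card F ≠ x) :
    x ^ Fintype.card F ^ 2 ≠ x := by
  intro h
  apply hx
  conv_rhs => rw [← pow_card_cube hK x, pow_succ, pow_mul, h]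

theorem natDegree_minpoly_eq_three (hK : Module.finrank F K = 3) {x : K}
    (hx : x ^ Fintype.card F ≠ x) : (minpoly F x).natDegree = 3 := by
  have : Module.Finite F K := Module.finite_of_finrank_eq_succ hK
  have dvd_three := minpoly.degree_dvd (isIntegral_of_finrank_eq_three hK x)
  rw [hK, Nat.dvd_prime Nat.prime_three] at dvd_three
  refine dvd_three.resolve_left fun degree_one => hx ?_
  obtain ⟨a, rfl⟩ := minpoly.natDegree_eq_one_iff.1 degree_one
  exact algebraMap_pow_card a

theorem map_eq_prod_of_aeval_eq_zero (hK : Module.finrank F K = 3) {x : K}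
    (hx : x ^ Fintype.card F ≠ x) {G : F[X]} (hG : G.Monic) (hd : G.natDegree = 3)
    (h0 : aeval x G = 0) : G.map (algebraMap F K) =
      (X - C x) * (X - C (x ^ Fintype.card F)) * (X - C (x ^ Fintype.card F ^ 2)) := by
  have h1 : aeval (x ^ Fintype.card F) G = 0 := by
    rw [aeval_pow_card, h0, zero_pow Fintype.card_ne_zero]
  have h2 : aeval (x ^ Fintype.card F ^ 2) G = 0 := by
    rw [sq, pow_mul, aeval_pow_card, h1, zero_pow Fintype.card_ne_zero]
  have hx12 : x ^ Fintype.card F ≠ x ^ Fintype.card F ^ 2 := by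
    intro h
    rw [sq, pow_mul] at h
    exact hx (pow_card_injective (F := F) h).symm
  have cop {u v : K} (h : u ≠ v) : IsCoprime (X - C u) (X - C v) :=
    isCoprime_X_sub_C_of_isUnit_sub (sub_ne_zero.2 h).isUnit
  have dvd {u : K} (h : aeval u G = 0) : X - C u ∣ G.map (algebraMap F K) := by
    rw [dvd_iff_isRoot, IsRoot.def, eval_map_algebraMap, h]
  refine eq_of_monic_of_dvd_of_natDegree_le
    (((monic_X_sub_C _).mul (monic_X_sub_C _)).mul (monic_X_sub_C _)) (hG.map _) ?_ ?_
  · exact (IsCoprime.mul_left (cop (pow_card_sq_ne hK hx).symm) (cop hx12)).mul_dvd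
      ((cop hx.symm).mul_dvd (dvd h0) (dvd h1)) (dvd h2)
  · rw [natDegree_map, hd, ((monic_X_sub_C _).mul (monic_X_sub_C _)).natDegree_mul
      (monic_X_sub_C _), (monic_X_sub_C _).natDegree_mul (monic_X_sub_C _), natDegree_X_sub_C,
      natDegree_X_sub_C, natDegree_X_sub_C]

theorem ne_zero_of_xCoord_pow_ne {Z : Points K A B}
    (hx : xCoord Z ^ Fintype.card F ≠ xCoord Z) : Z ≠ 0 := by
  rintro rfl
  exact hx (zero_pow Fintype.card_ne_zero)

section Frob

variable [DecidableEq K]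

@[simp]
theorem xCoord_frob (Z : Points K A B) : xCoord (frob Z) = xCoord Z ^ Fintype.card F := by
  rcases Z with _ | _
  · exact (zero_pow Fintype.card_ne_zero).symm
  · rfl

@[simp]
theorem yCoord_frob (Z : Points K A B) : yCoord (frob Z) = yCoord Z ^ Fintype.card F := by
  rcases Z with _ | _
  · exact (zero_pow Fintype.card_ne_zero).symm
  · rfl

theorem frob_injective : Function.Injective (frob : Points K A B → Points K A B) :=
  WeierstrassCurve.Affine.Point.map_injective _

theorem frob_ne_zero {Z : Points K A B} (hZ : Z ≠ 0) : frob Z ≠ 0 :=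
  (map_ne_zero_iff _ frob_injective).2 hZ

theorem xCoord_iterate_frob (n : ℕ) (Z : Points K A B) :
    xCoord (frob^[n] Z) = xCoord Z ^ Fintype.card F ^ n := by
  induction n with
  | zero => simp
  | succ n ih => rw [Function.iterate_succ_apply', xCoord_frob, ih, ← pow_mul, pow_succ]

theorem iterate_frob_ne_zero {Z : Points K A B} (hZ : Z ≠ 0) (n : ℕ) : frob^[n] Z ≠ 0 :=
  Function.Iterate.rec (· ≠ 0) hZ (fun _ => frob_ne_zero) n

theorem yCoord_frob_eq {a b : F} {Z : Points K A B}
    (hZ : yCoord Z = algebraMap F K a * xCoord Z + algebraMap F K b) :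
    yCoord (frob Z) = algebraMap F K a * xCoord (frob Z) + algebraMap F K b := by
  rw [yCoord_frob, xCoord_frob, hZ, mul_add_pow_card, algebraMap_pow_card, algebraMap_pow_card]

theorem exists_iterate_frob_of_isRoot {Z : Points K A B} {x : K}
    (hx : ((X - C (xCoord Z)) * (X - C (xCoord Z ^ Fintype.card F)) *
      (X - C (xCoord Z ^ Fintype.card F ^ 2))).IsRoot x) :
    ∃ n, x = xCoord (frob^[n] Z) := by
  simp only [IsRoot.def, eval_mul, eval_sub, eval_X, eval_C, mul_eq_zero, sub_eq_zero] at hx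
  simp only [xCoord_iterate_frob]
  rcases hx with (h | h) | h
  · exact ⟨0, by simpa using h⟩
  · exact ⟨1, by simpa using h⟩
  · exact ⟨2, h⟩

theorem exists_iterate_frob_of_minpoly_eq (hK : Module.finrank F K = 3) {Z Z' : Points K A B}
    (hZ' : Z' ≠ 0) (hx : xCoord Z ^ Fintype.card F ≠ xCoord Z)
    (h : minpoly F (xCoord Z) = minpoly F (xCoord Z')) :
    ∃ n, Z' = frob^[n] Z ∨ Z' = -frob^[n] Z := by
  have factor := map_eq_prod_of_aeval_eq_zero hK hx
    (minpoly.monic (isIntegral_of_finrank_eq_three hK _)) (natDegree_minpoly_eq_three hK hx)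
    (minpoly.aeval F (xCoord Z))
  obtain ⟨n, hn⟩ := exists_iterate_frob_of_isRoot (x := xCoord Z') (by
    rw [← factor, h, IsRoot.def, eval_map_algebraMap, minpoly.aeval])
  exact ⟨n, (xCoord_eq_iff hZ' (iterate_frob_ne_zero (ne_zero_of_xCoord_pow_ne hx) n)).1 hn⟩

end Frob

namespace IsLineOf

variable {L : Line F} {Z Z' : Points K A B}

theorem ne_zero (h : IsLineOf L Z) : Z ≠ 0 := by
  obtain ⟨x, y, h, rfl, -⟩ := h
  exact WeierstrassCurve.Affine.Point.some_ne_zero _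

theorem yCoord_eq (h : IsLineOf L Z) :
    yCoord Z = algebraMap F K L.a₁ * xCoord Z + algebraMap F K L.a₀ := by
  obtain ⟨x, y, h, rfl, hy, -⟩ := h
  exact hy

theorem map_eq (h : IsLineOf L Z) :
    (cubic A B - (C L.a₁ * X + C L.a₀) ^ 2).map (algebraMap F K) =
      (X - C (xCoord Z)) * (X - C (xCoord Z ^ Fintype.card F)) *
        (X - C (xCoord Z ^ Fintype.card F ^ 2)) := by
  obtain ⟨x, y, h, rfl, -, hf⟩ := h
  exact hf

theorem isIntersection (h : IsLineOf L Z) :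
    IsIntersection (algebraMap F K A) (algebraMap F K B) (algebraMap F K L.a₁)
      (algebraMap F K L.a₀) (xCoord Z) (xCoord Z ^ Fintype.card F)
      (xCoord Z ^ Fintype.card F ^ 2) := by
  refine .of_cubic_sub_eq (h.map_eq.symm.trans ?_).symm
  simp [cubic]

theorem of_yCoord_eq (hK : Module.finrank F K = 3) (hx : xCoord Z ^ Fintype.card F ≠ xCoord Z)
    (hy : yCoord Z = algebraMap F K L.a₁ * xCoord Z + algebraMap F K L.a₀) : IsLineOf L Z := by
  have hZ := ne_zero_of_xCoord_pow_ne hx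
  obtain ⟨h, e⟩ := exists_eq_some hZ
  refine ⟨_, _, h, e, hy, map_eq_prod_of_aeval_eq_zero hK hx (monic_cubic_sub_sq _ _ _ _)
    (natDegree_cubic_sub_sq _ _ _ _) ?_⟩
  simp only [cubic, map_sub, map_add, map_mul, map_pow, aeval_X, aeval_C, ← hy, yCoord_sq hZ]
  ring

theorem neg (hK : Module.finrank F K = 3) (hx : xCoord Z ^ Fintype.card F ≠ xCoord Z)
    (h : IsLineOf L Z) : IsLineOf L.neg (-Z) := by
  refine of_yCoord_eq hK (by rwa [xCoord_neg]) ?_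
  rw [yCoord_neg, xCoord_neg, h.yCoord_eq, Line.neg, map_neg, map_neg]
  ring

variable [DecidableEq K]

theorem frob (hK : Module.finrank F K = 3) (hx : xCoord Z ^ Fintype.card F ≠ xCoord Z)
    (h : IsLineOf L Z) : IsLineOf L (frob Z) := by
  refine of_yCoord_eq hK ?_ (yCoord_frob_eq h.yCoord_eq)
  rw [xCoord_frob]
  exact fun e => hx (pow_card_injective (F := F) e)

theorem exists_iterate_frob (h : IsLineOf L Z) (h' : IsLineOf L Z') :
    ∃ n, Z' = T3.frob^[n] Z := by
  obtain ⟨n, hn⟩ := exists_iterate_frob_of_isRoot (Z := Z) (x := xCoord Z') (by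
    rw [← h.map_eq, h'.map_eq]
    simp [IsRoot.def])
  have hy := Function.Iterate.rec (fun Q : Points K A B =>
      yCoord Q = algebraMap F K L.a₁ * xCoord Q + algebraMap F K L.a₀)
    h.yCoord_eq (fun _ => yCoord_frob_eq) n
  exact ⟨n, ext_coord h'.ne_zero (iterate_frob_ne_zero h.ne_zero n) hn
    (by rw [hy, ← hn, h'.yCoord_eq])⟩

end IsLineOf

theorem exists_isLineOf [DecidableEq K] (hK : Module.finrank F K = 3) {Z : Points K A B}
    (hZ : Z ∈ traceZero K A B) (hx : xCoord Z ^ Fintype.card F ≠ xCoord Z) :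
    ∃ L : Line F, IsLineOf L Z := by
  have hZ0 := ne_zero_of_xCoord_pow_ne hx
  have add_frob : Z + frob Z = -frob (frob Z) := eq_neg_of_add_eq_zero_left hZ
  obtain ⟨l, n, h0, h1, h2, -⟩ := exists_chord hZ0 (frob_ne_zero hZ0)
    (add_frob ▸ neg_ne_zero.2 (frob_ne_zero (frob_ne_zero hZ0)))
  rw [add_frob, xCoord_neg, yCoord_neg, neg_inj] at h2
  -- The chord and its conjugate `y = l ^ q * x + n ^ q` both pass through `φ(Z)` and `φ²(Z)`.
  have h1' : yCoord (frob Z) = l ^ Fintype.card F * xCoord (frob Z) + n ^ Fintype.card F := by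
    rw [yCoord_frob, h0, xCoord_frob, mul_add_pow_card]
  have h2' : yCoord (frob (frob Z)) =
      l ^ Fintype.card F * xCoord (frob (frob Z)) + n ^ Fintype.card F := by
    rw [yCoord_frob (frob Z), h1, xCoord_frob (frob Z), mul_add_pow_card]
  have hne : xCoord (frob Z) - xCoord (frob (frob Z)) ≠ 0 := by
    rw [sub_ne_zero, xCoord_frob, xCoord_frob, xCoord_frob]
    exact fun h => hx (pow_card_injective (F := F) h).symm
  have hl : l ^ Fintype.card F = l := by
    refine mul_right_cancel₀ hne ?_
    linear_combination h2' - h1' + h1 - h2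
  have hn : n ^ Fintype.card F = n := by
    rw [hl] at h1'
    linear_combination h1 - h1'
  obtain ⟨a, rfl⟩ := mem_range_of_pow_card_eq hl
  obtain ⟨b, rfl⟩ := mem_range_of_pow_card_eq hn
  exact ⟨⟨a, b⟩, .of_yCoord_eq hK hx h0⟩

end Frobenius

/-- `b` is `s ^ i * a` for some `i`: the indices of a point and of its conjugates under the
Frobenius endomorphism, when that endomorphism acts as multiplication by `s`. -/
def Conj {R : Type*} [Monoid R] (s a b : R) : Prop := ∃ i : ℕ, b = s ^ i * a

namespace Conj

theorem refl {R : Type*} [Monoid R] (s a : R) : Conj s a a := ⟨0, by simp⟩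

theorem trans {R : Type*} [Monoid R] {s a b c : R} (h : Conj s a b) (h' : Conj s b c) :
    Conj s a c := by
  obtain ⟨i, rfl⟩ := h
  obtain ⟨j, rfl⟩ := h'
  exact ⟨j + i, by rw [pow_add, mul_assoc]⟩

theorem symm {R : Type*} [Monoid R] {s a b : R} (hs : s ^ 3 = 1) (h : Conj s a b) :
    Conj s b a := by
  obtain ⟨i, rfl⟩ := h
  exact ⟨2 * i, by rw [← mul_assoc, ← pow_add, show 2 * i + i = 3 * i by ring, pow_mul, hs, one_pow,
    one_mul]⟩

theorem neg {R : Type*} [Ring R] {s a b : R} (h : Conj s a b) : Conj s (-a) (-b) := by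
  obtain ⟨i, rfl⟩ := h
  exact ⟨i, by rw [mul_neg]⟩

theorem prop_of_mul {R : Type*} [Monoid R] {s a b : R} (motive : R → Prop) (h : Conj s a b)
    (mul : ∀ c, motive c → motive (s * c)) (base : motive a) : motive b := by
  obtain ⟨i, rfl⟩ := h
  induction i with
  | zero => simpa using base
  | succ i ih => simpa only [pow_succ', mul_assoc] using mul _ ih

end Conj

theorem conj_iff_of_cube_eq_one {R : Type*} [Monoid R] {s a b : R} (hs : s ^ 3 = 1) :
    Conj s a b ↔ b = a ∨ b = s * a ∨ b = s ^ 2 * a := by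
  constructor
  · rintro ⟨i, rfl⟩
    have lt := Nat.mod_lt i three_pos
    rw [← Nat.div_add_mod i 3, pow_add, pow_mul, hs, one_pow, one_mul]
    interval_cases i % 3 <;> simp
  · rintro (rfl | rfl | rfl)
    exacts [.refl s b, ⟨1, by rw [pow_one]⟩, ⟨2, rfl⟩]

/-- `z` is a conjugate of `a` plus a conjugate of `b`, as are the indices of the zeros of the
function `S` computed from the lines of two points with indices `a` and `b`. -/
def IsConjSum {R : Type*} [Semiring R] (s a b z : R) : Prop := ∃ i j : ℕ, z = s ^ i * a + s ^ j * b

theorem isConjSum_iff_of_cube_eq_one {R : Type*} [CommSemiring R] {s a b z : R} (hs : s ^ 3 = 1) :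
    IsConjSum s a b z ↔
      Conj s (a + b) z ∨ Conj s (a + s * b) z ∨ Conj s (a + s ^ 2 * b) z := by
  constructor
  · rintro ⟨i, j, rfl⟩
    have factor : Conj s (a + s ^ (2 * i + j) * b) (s ^ i * a + s ^ j * b) := by
      refine ⟨i, ?_⟩
      rw [mul_add, ← mul_assoc, ← pow_add, show i + (2 * i + j) = 3 * i + j by ring, pow_add,
        pow_mul, hs, one_pow, one_mul]
    rcases (conj_iff_of_cube_eq_one hs).1 ⟨2 * i + j, rfl⟩ with h | h | h <;> rw [h] at factor
    exacts [.inl factor, .inr (.inl factor), .inr (.inr factor)]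
  · rintro (⟨i, rfl⟩ | ⟨i, rfl⟩ | ⟨i, rfl⟩)
    exacts [⟨i, i, by ring⟩, ⟨i, i + 1, by ring⟩, ⟨i, i + 2, by ring⟩]

theorem cube_eq_one_of_rel {R : Type*} [CommRing R] {s : R} (h : s ^ 2 + s + 1 = 0) :
    s ^ 3 = 1 := by
  linear_combination (s - 1) * h

section Functions

variable {F : Type*} [Field F] {K : Type*} [Field K] [Algebra F K] {A B : F}

/-- The function `S₁ + y S₂` vanishes at `Z`. -/
def VanishesAt (S : F[X] × F[X]) (Z : Points K A B) : Prop :=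
  aeval (xCoord Z) S.1 + yCoord Z * aeval (xCoord Z) S.2 = 0

theorem VanishesAt.frob [Fintype F] [DecidableEq K] {S : F[X] × F[X]} {Z : Points K A B}
    (h : VanishesAt S Z) : VanishesAt S (frob Z) := by
  unfold VanishesAt at *
  rw [xCoord_frob, yCoord_frob, aeval_pow_card, aeval_pow_card, add_comm, ← mul_add_pow_card,
    add_comm, h, zero_pow Fintype.card_ne_zero]

theorem aeval_sigma {S : F[X] × F[X]} {Z : Points K A B} (hZ : Z ≠ 0) :
    aeval (xCoord Z) (sigma A B S) =
      (aeval (xCoord Z) S.1 + yCoord Z * aeval (xCoord Z) S.2) *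
        (yCoord Z * aeval (xCoord Z) S.2 - aeval (xCoord Z) S.1) := by
  have h := yCoord_sq hZ
  simp only [sigma, cubic, map_sub, map_add, map_mul, map_pow, aeval_X, aeval_C]
  linear_combination -(aeval (xCoord Z) S.2) ^ 2 * h

theorem VanishesAt.minpoly_dvd_sigma {S : F[X] × F[X]} {Z : Points K A B} (hZ : Z ≠ 0)
    (h : VanishesAt S Z) : minpoly F (xCoord Z) ∣ sigma A B S := by
  refine minpoly.dvd F _ ?_
  rw [aeval_sigma hZ, show _ + _ = (0 : K) from h, zero_mul]

theorem minpoly_dvd_snd_of_vanishesAt_neg (h2 : (2 : K) ≠ 0) {S : F[X] × F[X]}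
    {Z : Points K A B} (hy : yCoord Z ≠ 0) (h : VanishesAt S Z) (h' : VanishesAt S (-Z)) :
    minpoly F (xCoord Z) ∣ S.2 := by
  unfold VanishesAt at *
  rw [xCoord_neg, yCoord_neg] at h'
  have : (2 * yCoord Z) * aeval (xCoord Z) S.2 = 0 := by linear_combination h - h'
  exact minpoly.dvd F _ ((mul_eq_zero.1 this).resolve_left (mul_ne_zero h2 hy))

theorem IsLineOf.minpoly_dvd_iff [Fintype F] {L : Line F} {Z : Points K A B} (h : IsLineOf L Z)
    {S : F[X] × F[X]} : minpoly F (xCoord Z) ∣ S.1 + (C L.a₁ * X + C L.a₀) * S.2 ↔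
      VanishesAt S Z := by
  rw [minpoly.dvd_iff, VanishesAt, h.yCoord_eq]
  simp

end Functions

section TraceZeroParam

variable {F : Type*} [Field F] [Fintype F] {K : Type*} [Field K] [DecidableEq K] [Algebra F K]
  {A B : F}

/-- A parametrization `pt` of a group of points of trace zero by a ring `R`, in which the Frobenius
endomorphism becomes multiplication by `s`. In the application `R = ℤ/p` and `pt a = a P`. -/
structure TraceZeroParam {R : Type*} [CommRing R] (s : R) (pt : R →+ Points K A B) : Prop where
  finrank_eq : Module.finrank F K = 3
  two_ne_zero : (2 : K) ≠ 0
  index_two_ne_zero : (2 : R) ≠ 0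
  index_three_ne_zero : (3 : R) ≠ 0
  injective : Function.Injective pt
  frob_pt : ∀ a, frob (pt a) = pt (s * a)
  rel : s ^ 2 + s + 1 = 0

/-- The minimal polynomial over `F` of the abscissa of `pt a`. -/
noncomputable abbrev minX {R : Type*} [Ring R] (pt : R →+ Points K A B) (a : R) : F[X] :=
  minpoly F (xCoord (pt a))

namespace TraceZeroParam

variable {R : Type*} [CommRing R] {s : R} {pt : R →+ Points K A B}

theorem cube_eq_one (H : TraceZeroParam s pt) : s ^ 3 = 1 :=
  cube_eq_one_of_rel H.rel

theorem pt_ne_zero (H : TraceZeroParam s pt) {a : R} (ha : a ≠ 0) : pt a ≠ 0 :=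
  (map_ne_zero_iff pt H.injective).2 ha

theorem iterate_frob_pt (H : TraceZeroParam s pt) (n : ℕ) (a : R) :
    frob^[n] (pt a) = pt (s ^ n * a) := by
  induction n with
  | zero => simp
  | succ n ih => rw [Function.iterate_succ_apply', ih, H.frob_pt, pow_succ', mul_assoc]

theorem pt_mem_traceZero (H : TraceZeroParam s pt) (a : R) : pt a ∈ traceZero K A B := by
  change pt a + frob (pt a) + frob (frob (pt a)) = 0
  rw [H.frob_pt, H.frob_pt, ← map_add, ← map_add,
    show a + s * a + s * (s * a) = 0 by linear_combination a * H.rel, map_zero]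

theorem conj_symm (H : TraceZeroParam s pt) {a b : R} (h : Conj s a b) : Conj s b a :=
  h.symm H.cube_eq_one

theorem conj_of_isLineOf (H : TraceZeroParam s pt) {a b : R} {L : Line F}
    (h : IsLineOf L (pt a)) (h' : IsLineOf L (pt b)) : Conj s a b := by
  obtain ⟨n, hn⟩ := h.exists_iterate_frob h'
  exact ⟨n, H.injective (by rw [hn, H.iterate_frob_pt])⟩

theorem minX_eq_of_conj (H : TraceZeroParam s pt) {a b : R} (hab : Conj s a b) :
    minX pt b = minX pt a := by
  refine hab.prop_of_mul (fun c => minX pt c = minX pt a)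
    (fun c ih => ?_) rfl
  rw [minX, ← H.frob_pt, xCoord_frob, ← ih]
  exact minpoly.algHom_eq (FiniteField.frobeniusAlgHom F K) (pow_card_injective (F := F)) _

theorem irreducible_minX (H : TraceZeroParam s pt) (a : R) :
    Irreducible (minX pt a) :=
  minpoly.irreducible (isIntegral_of_finrank_eq_three H.finrank_eq _)

theorem monic_minX (H : TraceZeroParam s pt) (a : R) :
    (minX pt a).Monic :=
  minpoly.monic (isIntegral_of_finrank_eq_three H.finrank_eq _)

theorem vanishesAt_of_conj (H : TraceZeroParam s pt) {S : F[X] × F[X]} {a b : R}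
    (h : VanishesAt S (pt a)) (hab : Conj s a b) : VanishesAt S (pt b) :=
  hab.prop_of_mul (VanishesAt S <| pt ·) (fun c hc => H.frob_pt c ▸ hc.frob) h

theorem ne_zero_of_isLineOf {a : R} {L : Line F} (h : IsLineOf L (pt a)) : a ≠ 0 := by
  rintro rfl
  exact h.ne_zero (map_zero pt)

variable [IsDomain R]

theorem s_ne_zero (H : TraceZeroParam s pt) : s ≠ 0 := by
  rintro rfl
  exact one_ne_zero (by simpa using H.rel : (1 : R) = 0)

theorem ne_neg (H : TraceZeroParam s pt) {a : R} (ha : a ≠ 0) : a ≠ -a := fun h =>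
  mul_ne_zero H.index_two_ne_zero ha (by linear_combination h)

theorem yCoord_ne_zero (H : TraceZeroParam s pt) {a : R} (ha : a ≠ 0) : yCoord (pt a) ≠ 0 := by
  intro h
  refine H.ne_neg ha (H.injective (ext_coord (H.pt_ne_zero ha) (H.pt_ne_zero (neg_ne_zero.2 ha))
    ?_ ?_)) <;> simp [h]

theorem not_conj_neg (H : TraceZeroParam s pt) {a : R} (ha : a ≠ 0) : ¬Conj s a (-a) := by
  rintro ⟨i, h⟩
  have pow_eq : s ^ i = -1 := mul_right_cancel₀ ha (by rw [neg_one_mul, h])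
  have pow_cube : (s ^ i) ^ 3 = 1 := by rw [← pow_mul, mul_comm, pow_mul, H.cube_eq_one, one_pow]
  rw [pow_eq] at pow_cube
  exact H.index_two_ne_zero (by linear_combination -pow_cube)

theorem xCoord_pow_ne (H : TraceZeroParam s pt) {a : R} (ha : a ≠ 0) :
    xCoord (pt a) ^ Fintype.card F ≠ xCoord (pt a) := by
  rw [← xCoord_frob, H.frob_pt, Ne,
    xCoord_eq_iff (H.pt_ne_zero (mul_ne_zero H.s_ne_zero ha)) (H.pt_ne_zero ha), ← map_neg,
    H.injective.eq_iff, H.injective.eq_iff, mul_eq_right₀ ha, ← neg_one_mul, mul_left_inj' ha]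
  have rel := H.rel
  rintro (rfl | rfl)
  · exact H.index_three_ne_zero (by linear_combination rel)
  · exact one_ne_zero (by linear_combination rel : (1 : R) = 0)

theorem exists_isLineOf (H : TraceZeroParam s pt) {a : R} (ha : a ≠ 0) :
    ∃ L : Line F, IsLineOf L (pt a) :=
  T3.exists_isLineOf H.finrank_eq (H.pt_mem_traceZero a) (H.xCoord_pow_ne ha)

theorem isLineOf_of_conj (H : TraceZeroParam s pt) {a b : R} {L : Line F}
    (h : IsLineOf L (pt a)) (hab : Conj s a b) : IsLineOf L (pt b) :=
  hab.prop_of_mul (IsLineOf L <| pt ·) (fun c hc =>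
    H.frob_pt c ▸ hc.frob H.finrank_eq (H.xCoord_pow_ne (ne_zero_of_isLineOf hc))) h

theorem isLineOf_unique (H : TraceZeroParam s pt) (h2 : ringChar F ≠ 2) {a b : R}
    {L L' : Line F} (h : IsLineOf L (pt a)) (h' : IsLineOf L' (pt b)) (hab : Conj s a b) :
    L = L' :=
  (H.isLineOf_of_conj h hab).unique h2 h'

theorem isLineOf_neg (H : TraceZeroParam s pt) {a : R} {L : Line F} (h : IsLineOf L (pt a)) :
    IsLineOf L.neg (pt (-a)) := by
  rw [map_neg]
  exact h.neg H.finrank_eq (H.xCoord_pow_ne (ne_zero_of_isLineOf h))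

theorem conj_or_of_minX_eq (H : TraceZeroParam s pt) {a b : R} (ha : a ≠ 0) (hb : b ≠ 0)
    (h : minX pt a = minX pt b) :
    Conj s a b ∨ Conj s a (-b) := by
  obtain ⟨n, hn⟩ := exists_iterate_frob_of_minpoly_eq H.finrank_eq (H.pt_ne_zero hb)
    (H.xCoord_pow_ne ha) h
  rw [H.iterate_frob_pt, ← map_neg, H.injective.eq_iff, H.injective.eq_iff,
    ← neg_eq_iff_eq_neg] at hn
  exact hn.imp (⟨n, ·⟩) (⟨n, ·⟩)

theorem natDegree_minX (H : TraceZeroParam s pt) {a : R} (ha : a ≠ 0) :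
    (minX pt a).natDegree = 3 :=
  natDegree_minpoly_eq_three H.finrank_eq (H.xCoord_pow_ne ha)

end TraceZeroParam

end TraceZeroParam

section Formulas

variable {F : Type*} [Field F]

theorem sScale_ne_zero (A B : F) (L L' : Line F) : sScale A B L L' ≠ 0 := by
  unfold sScale
  split_ifs with h
  · exact one_ne_zero
  · exact inv_ne_zero h

theorem natDegree_sPoly_fst_le (A B : F) (L L' : Line F) : (sPoly A B L L').1.natDegree ≤ 4 := by
  refine (natDegree_C_mul_le _ _).trans ?_
  compute_degree

theorem sPoly_snd_eq_toPoly {A B : F} {L L' : Line F}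
    (h : sB3 A B L.a₁ L.a₀ L'.a₁ L'.a₀ ≠ 0) : (sPoly A B L L').2 =
      (⟨1, sScale A B L L' * sB2 A B L.a₁ L.a₀ L'.a₁ L'.a₀,
        sScale A B L L' * sB1 A B L.a₁ L.a₀ L'.a₁ L'.a₀,
        sScale A B L L' * sB0 A B L.a₁ L.a₀ L'.a₁ L'.a₀⟩ : Cubic F).toPoly := by
  have scale_mul : sScale A B L L' * sB3 A B L.a₁ L.a₀ L'.a₁ L'.a₀ = 1 := by
    rw [sScale, if_neg h, inv_mul_cancel₀ h]
  rw [← scale_mul]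
  simp only [sPoly, Cubic.toPoly, C_mul]
  ring

theorem monic_sPoly_snd {A B : F} {L L' : Line F} (h : sB3 A B L.a₁ L.a₀ L'.a₁ L'.a₀ ≠ 0) :
    (sPoly A B L L').2.Monic := by
  rw [sPoly_snd_eq_toPoly h]
  exact Cubic.monic_of_a_eq_one'

theorem natDegree_sPoly_snd {A B : F} {L L' : Line F} (h : sB3 A B L.a₁ L.a₀ L'.a₁ L'.a₀ ≠ 0) :
    (sPoly A B L L').2.natDegree = 3 := by
  rw [sPoly_snd_eq_toPoly h]
  exact Cubic.natDegree_of_a_ne_zero' one_ne_zero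

theorem sPoly_neg_snd (A B : F) (L : Line F) : (sPoly A B L L.neg).2 = 0 := by
  simp only [sPoly, Line.neg, sB3_neg, sB2_neg, sB1_neg, sB0_neg, C_0, zero_mul, add_zero,
    mul_zero]

theorem natDegree_sPoly_neg_fst {A B : F} {L : Line F}
    (h : sA3 A B L.a₁ L.a₀ (-L.a₁) (-L.a₀) ≠ 0) : (sPoly A B L L.neg).1.natDegree = 3 := by
  rw [sPoly, natDegree_C_mul (sScale_ne_zero A B L L.neg)]
  simp only [Line.neg, sA4_neg, C_0, zero_mul, zero_add]
  exact natDegree_cubic h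

variable {A B : F} {S : F[X] × F[X]}

theorem degree_sq_lt_degree_cubic_mul (h1 : S.1.natDegree ≤ 4) (h2 : S.2.Monic)
    (h3 : S.2.natDegree = 3) : (cubic A B * S.2 ^ 2).Monic ∧
      (cubic A B * S.2 ^ 2).natDegree = 9 ∧ (S.1 ^ 2).natDegree < 9 := by
  have cubic_eq : cubic A B = (⟨1, 0, A, B⟩ : Cubic F).toPoly := by simp [cubic, Cubic.toPoly]
  have monic : (cubic A B).Monic := cubic_eq ▸ Cubic.monic_of_a_eq_one'
  have natDegree : (cubic A B).natDegree = 3 :=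
    cubic_eq ▸ Cubic.natDegree_of_a_ne_zero' one_ne_zero
  refine ⟨monic.mul (h2.pow 2), ?_, (natDegree_pow_le_of_le 2 h1).trans_lt (by norm_num)⟩
  rw [monic.natDegree_mul (h2.pow 2), h2.natDegree_pow, natDegree, h3]

theorem monic_sigma (h1 : S.1.natDegree ≤ 4) (h2 : S.2.Monic) (h3 : S.2.natDegree = 3) :
    (sigma A B S).Monic := by
  obtain ⟨monic, natDegree, lt⟩ := degree_sq_lt_degree_cubic_mul (A := A) (B := B) h1 h2 h3
  exact monic.sub_of_left (degree_lt_degree (lt.trans_eq natDegree.symm))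

theorem natDegree_sigma (h1 : S.1.natDegree ≤ 4) (h2 : S.2.Monic) (h3 : S.2.natDegree = 3) :
    (sigma A B S).natDegree = 9 := by
  obtain ⟨-, natDegree, lt⟩ := degree_sq_lt_degree_cubic_mul (A := A) (B := B) h1 h2 h3
  rw [sigma, natDegree_sub_eq_left_of_natDegree_lt (lt.trans_eq natDegree.symm), natDegree]

variable {K : Type*} [Field K] [Algebra F K]

theorem aeval_sPoly (A B : F) (L L' : Line F) (x y : K) :
    aeval x (sPoly A B L L').1 + y * aeval x (sPoly A B L L').2 =
      algebraMap F K (sScale A B L L') * sVal (algebraMap F K A) (algebraMap F K B)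
        (algebraMap F K L.a₁) (algebraMap F K L.a₀) (algebraMap F K L'.a₁) (algebraMap F K L'.a₀)
        x y := by
  simp only [sPoly, sVal, sA4, sA3, sA2, sA1, sA0, sB3, sB2, sB1, sB0, map_add, map_sub, map_neg,
    map_mul, map_pow, map_ofNat, aeval_C, aeval_X]
  ring

theorem map_sA3 {F K : Type*} [Field F] [Field K] (f : F →+* K) (A B a a₀ b b₀ : F) :
    f (sA3 A B a a₀ b b₀) = sA3 (f A) (f B) (f a) (f a₀) (f b) (f b₀) := by
  simp only [sA3, map_add, map_sub, map_mul, map_pow, map_ofNat]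

theorem map_sB3 {F K : Type*} [Field F] [Field K] (f : F →+* K) (A B a a₀ b b₀ : F) :
    f (sB3 A B a a₀ b b₀) = sB3 (f A) (f B) (f a) (f a₀) (f b) (f b₀) := by
  simp only [sB3, map_add, map_sub, map_mul, map_pow, map_ofNat]

theorem map_dblC {F K : Type*} [Field F] [Field K] (f : F →+* K) (A B a a₀ : F) :
    f (dblC A B a a₀) = dblC (f A) (f B) (f a) (f a₀) := by
  simp only [dblC, map_sub, map_mul, map_pow, map_ofNat]

theorem map_dblU1 {F K : Type*} [Field F] [Field K] (f : F →+* K) (A B a a₀ : F) :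
    f (dblU1 A B a a₀) = dblU1 (f A) (f B) (f a) (f a₀) := by
  simp only [dblU1, map_add, map_sub, map_mul, map_pow, map_ofNat]

theorem map_dblU0 {F K : Type*} [Field F] [Field K] (f : F →+* K) (A B a a₀ : F) :
    f (dblU0 A B a a₀) = dblU0 (f A) (f B) (f a) (f a₀) := by
  simp only [dblU0, map_add, map_sub, map_neg, map_mul, map_pow, map_ofNat]

end Formulas

section GroupLaw

variable {F : Type*} [Field F] [Fintype F] {K : Type*} [Field K] [DecidableEq K] [Algebra F K]
  {A B : F}

theorem IsLineOf.vanishesAt_sPoly {L L' : Line F} {Q R : Points K A B} (h : IsLineOf L Q)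
    (h' : IsLineOf L' R) (hQR : Q + R ≠ 0) : VanishesAt (sPoly A B L L') (Q + R) := by
  obtain ⟨l, n, hQ, hR, hy, chord⟩ := exists_chord h.ne_zero h'.ne_zero hQR
  rw [VanishesAt, hy, aeval_sPoly, sVal_eq_zero_of_chord chord (h.yCoord_eq.symm.trans hQ)
    (h'.yCoord_eq.symm.trans hR), mul_zero]

theorem IsLineOf.dblC_mul_yCoord {L : Line F} {Q : Points K A B} (h : IsLineOf L Q)
    (hQ : Q + Q ≠ 0) :
    algebraMap F K (dblC A B L.a₁ L.a₀) * yCoord (Q + Q) =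
      algebraMap F K (dblU1 A B L.a₁ L.a₀) * xCoord (Q + Q) +
        algebraMap F K (dblU0 A B L.a₁ L.a₀) := by
  obtain ⟨l, n, hQ, -, hy, chord⟩ := exists_chord h.ne_zero h.ne_zero hQ
  rw [hy, map_dblC, map_dblU1, map_dblU0, dbl_eval_of_tangent chord (h.yCoord_eq.symm.trans hQ)]

namespace TraceZeroParam

variable {R : Type*} [CommRing R] {s : R} {pt : R →+ Points K A B}

theorem isIntersection (H : TraceZeroParam s pt) {a : R} {L : Line F} (h : IsLineOf L (pt a)) :
    IsIntersection (algebraMap F K A) (algebraMap F K B) (algebraMap F K L.a₁)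
      (algebraMap F K L.a₀) (xCoord (pt a)) (xCoord (pt (s * a))) (xCoord (pt (s ^ 2 * a))) := by
  have key := h.isIntersection
  rwa [← xCoord_frob, ← xCoord_iterate_frob, H.iterate_frob_pt, H.frob_pt] at key

theorem conj_of_conj_pow_mul (H : TraceZeroParam s pt) {a b : R} {i : ℕ}
    (h : Conj s a (s ^ i * b)) : Conj s a b :=
  h.trans (H.conj_symm ⟨i, rfl⟩)

theorem add_pow_mul_ne_zero (H : TraceZeroParam s pt) {a b : R} (hab : ¬Conj s a (-b)) (i : ℕ) :
    a + s ^ i * b ≠ 0 := fun h =>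
  hab (H.conj_of_conj_pow_mul (i := i) ⟨0, by linear_combination -h⟩)

theorem s_sub_one_ne_zero (H : TraceZeroParam s pt) : s - 1 ≠ 0 := by
  intro h
  have rel := H.rel
  rw [sub_eq_zero.1 h] at rel
  exact H.index_three_ne_zero (by linear_combination rel)

variable [IsDomain R]

theorem not_conj_add_mul (H : TraceZeroParam s pt) {a b : R} (ha : a ≠ 0) (hb : b ≠ 0)
    (hab : ¬Conj s a b) : ¬Conj s (a + b) (a + s * b) := by
  have s_sub_one_ne_zero := H.s_sub_one_ne_zero
  rw [conj_iff_of_cube_eq_one H.cube_eq_one]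
  rintro (h | h | h)
  · exact mul_ne_zero s_sub_one_ne_zero hb (by linear_combination h)
  · exact mul_ne_zero s_sub_one_ne_zero ha (by linear_combination -h)
  · refine hab ⟨1, mul_left_cancel₀ (mul_ne_zero s_sub_one_ne_zero H.s_ne_zero) ?_⟩
    linear_combination -h - a * (s - 1) * H.rel

theorem not_conj_add_pow_mul_succ (H : TraceZeroParam s pt) {a b : R} (ha : a ≠ 0) (hb : b ≠ 0)
    (hab : ¬Conj s a b) (i : ℕ) : ¬Conj s (a + s ^ i * b) (a + s ^ (i + 1) * b) := by
  rw [pow_succ', mul_assoc]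
  exact H.not_conj_add_mul ha (mul_ne_zero (pow_ne_zero i H.s_ne_zero) hb)
    (fun h => hab (H.conj_of_conj_pow_mul h))

theorem sB3_ne_zero (H : TraceZeroParam s pt) {a b : R} {L L' : Line F}
    (h : IsLineOf L (pt a)) (h' : IsLineOf L' (pt b)) (hab : ¬Conj s a (-b)) :
    sB3 A B L.a₁ L.a₀ L'.a₁ L'.a₀ ≠ 0 := by
  have add_ne_zero {c : R} (hc : Conj s a c) :
      (algebraMap F K L.a₁ + algebraMap F K L'.a₁) * xCoord (pt c) +
        (algebraMap F K L.a₀ + algebraMap F K L'.a₀) ≠ 0 := by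
    intro h0
    have hLc := H.isLineOf_of_conj h hc
    have hL' : IsLineOf L' (pt (-c)) := by
      refine .of_yCoord_eq H.finrank_eq
        (H.xCoord_pow_ne (neg_ne_zero.2 (ne_zero_of_isLineOf hLc))) ?_
      rw [map_neg, xCoord_neg, yCoord_neg, hLc.yCoord_eq]
      linear_combination -h0
    exact hab (hc.trans (by simpa using (H.conj_of_isLineOf hL' h').neg))
  rw [← (algebraMap F K).injective.ne_iff, map_zero, map_sB3, sB3_eq_prod (H.isIntersection h)]
  exact mul_ne_zero (mul_ne_zero (add_ne_zero (.refl s a)) (add_ne_zero ⟨1, by rw [pow_one]⟩))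
    (add_ne_zero ⟨2, rfl⟩)

theorem dblC_ne_zero (H : TraceZeroParam s pt) {a : R} {L : Line F} (h : IsLineOf L (pt a)) :
    dblC A B L.a₁ L.a₀ ≠ 0 := by
  have line_ne_zero {c : R} (hc : Conj s a c) :
      algebraMap F K L.a₁ * xCoord (pt c) + algebraMap F K L.a₀ ≠ 0 := by
    have hLc := H.isLineOf_of_conj h hc
    rw [← hLc.yCoord_eq]
    exact H.yCoord_ne_zero (ne_zero_of_isLineOf hLc)
  rw [← (algebraMap F K).injective.ne_iff, map_zero, map_dblC, dblC_eq_prod (H.isIntersection h)]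
  refine mul_ne_zero ?_ (mul_ne_zero (mul_ne_zero (line_ne_zero (.refl s a))
    (line_ne_zero ⟨1, by rw [pow_one]⟩)) (line_ne_zero ⟨2, rfl⟩))
  rw [show (-8 : K) = -2 ^ 3 by norm_num]
  exact neg_ne_zero.2 (pow_ne_zero 3 H.two_ne_zero)

theorem isLineOf_dbl (H : TraceZeroParam s pt) {a : R} {L : Line F} (h : IsLineOf L (pt a)) :
    ∃ L' : Line F, dbl A B L = some L' ∧ IsLineOf L' (pt (2 * a)) := by
  have two_mul_ne_zero := mul_ne_zero H.index_two_ne_zero (ne_zero_of_isLineOf h)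
  have double := h.dblC_mul_yCoord (by
    rw [← map_add, ← two_mul]
    exact H.pt_ne_zero two_mul_ne_zero)
  rw [← map_add, ← two_mul] at double
  refine ⟨_, if_neg (H.dblC_ne_zero h),
    .of_yCoord_eq H.finrank_eq (H.xCoord_pow_ne two_mul_ne_zero) ?_⟩
  have := (map_ne_zero (algebraMap F K)).2 (H.dblC_ne_zero h)
  rw [map_div₀, map_div₀]
  field_simp
  linear_combination double

end TraceZeroParam

end GroupLaw

section LinearSystem

variable {F : Type*} [Field F]

theorem dvd_iff_C_mul_eq_of_monic_of_natDegree_eq_three {W G : F[X]} (hW : W.Monic)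
    (hWd : W.natDegree = 3) (hW0 : W.coeff 0 ≠ 0) (hG : G.natDegree ≤ 4) :
    W ∣ G ↔ C (W.coeff 0) * G = W * (C (W.coeff 0 * G.coeff 4) * X + C (G.coeff 0)) := by
  constructor
  · rintro ⟨Q, rfl⟩
    have hQ : Q.natDegree ≤ 1 := by
      by_cases h0 : Q = 0
      · simp [h0]
      · rw [hW.natDegree_mul' h0] at hG
        omega
    obtain ⟨u, v, rfl⟩ := exists_eq_X_add_C_of_natDegree_le_one hQ
    have hW3 : W.coeff 3 = 1 := by rw [← hWd]; exact hW
    have hW4 : W.coeff 4 = 0 := coeff_eq_zero_of_natDegree_lt (by omega)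
    have coeff_four : (W * (C u * X + C v)).coeff 4 = u := by
      simp [mul_add, ← mul_assoc, hW3, hW4]
    rw [coeff_four, mul_coeff_zero]
    simp only [coeff_add, coeff_mul_X_zero, coeff_C_zero, zero_add, C_mul]
    ring
  · intro h
    exact ((isUnit_C.2 hW0.isUnit).dvd_mul_left).1 ⟨_, h⟩

theorem dvd_iff_coeff_of_monic_of_natDegree_eq_three {W G : F[X]} (hW : W.Monic)
    (hWd : W.natDegree = 3) (hW0 : W.coeff 0 ≠ 0) (hG : G.natDegree ≤ 4) : W ∣ G ↔
      W.coeff 0 * G.coeff 3 = W.coeff 2 * (W.coeff 0 * G.coeff 4) + G.coeff 0 ∧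
      W.coeff 0 * G.coeff 2 = W.coeff 1 * (W.coeff 0 * G.coeff 4) + W.coeff 2 * G.coeff 0 ∧
      W.coeff 0 * G.coeff 1 = W.coeff 0 * (W.coeff 0 * G.coeff 4) + W.coeff 1 * G.coeff 0 := by
  have hW3 : W.coeff 3 = 1 := by rw [← hWd]; exact hW
  have hW4 : W.coeff 4 = 0 := coeff_eq_zero_of_natDegree_lt (by omega)
  rw [dvd_iff_C_mul_eq_of_monic_of_natDegree_eq_three hW hWd hW0 hG,
    ext_iff_natDegree_le (n := 4) ((natDegree_C_mul_le _ _).trans hG)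
      (natDegree_mul_le_of_le hWd.le natDegree_linear_le)]
  simp only [← Nat.lt_succ_iff, Nat.forall_lt_succ_right, Nat.succ_eq_add_one]
  simp only [not_lt_zero, coeff_C_mul, C_mul, mul_add, ← mul_assoc, coeff_add, coeff_mul_C,
    IsEmpty.forall_iff, implies_true, mul_coeff_zero, coeff_C_zero, coeff_X_zero, mul_zero,
    zero_add, and_self, coeff_mul_X, true_and, hW3, one_mul, hW4, zero_mul, add_zero, and_true]
  exact ⟨fun ⟨⟨h1, h2⟩, h3⟩ => ⟨h3, h2, h1⟩, fun ⟨h3, h2, h1⟩ => ⟨⟨h1, h2⟩, h3⟩⟩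

theorem solvesSystem_iff_dvd {W : F[X]} {S : F[X] × F[X]} (hW : W.Monic) (hWd : W.natDegree = 3)
    (hW0 : W.coeff 0 ≠ 0) (h1 : S.1.natDegree ≤ 4) (h2 : S.2.Monic) (h2d : S.2.natDegree = 3)
    (L : Line F) : SolvesSystem W S L ↔ W ∣ S.1 + (C L.a₁ * X + C L.a₀) * S.2 := by
  have hS3 : S.2.coeff 3 = 1 := by rw [← h2d]; exact h2
  have hS4 : S.2.coeff 4 = 0 := coeff_eq_zero_of_natDegree_lt (by omega)
  rw [dvd_iff_coeff_of_monic_of_natDegree_eq_three hW hWd hW0 (natDegree_add_le_of_degree_le h1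
    (natDegree_mul_le_of_le natDegree_linear_le h2d.le)), SolvesSystem]
  simp only [mul_assoc, add_mul, coeff_add, coeff_C_mul, coeff_X_mul, hS3, mul_one, hS4, mul_zero,
    add_zero, mul_coeff_zero, coeff_C_zero, coeff_X_zero, zero_mul, zero_add]
  exact and_congr ⟨fun h => by linear_combination -h, fun h => by linear_combination -h⟩
    (and_congr ⟨fun h => by linear_combination -h, fun h => by linear_combination -h⟩
      ⟨fun h => by linear_combination -h, fun h => by linear_combination -h⟩)

theorem line_eq_of_dvd {W S₁ S₂ : F[X]} (hW : Irreducible W) (hWd : 1 < W.natDegree)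
    (hS : ¬W ∣ S₂) {L L' : Line F} (h : W ∣ S₁ + (C L.a₁ * X + C L.a₀) * S₂)
    (h' : W ∣ S₁ + (C L'.a₁ * X + C L'.a₀) * S₂) : L = L' := by
  have dvd_mul : W ∣ (C (L.a₁ - L'.a₁) * X + C (L.a₀ - L'.a₀)) * S₂ := by
    convert dvd_sub h h' using 1
    simp only [C_sub]
    ring
  have zero := eq_zero_of_dvd_of_natDegree_lt ((hW.prime.dvd_or_dvd dvd_mul).resolve_right hS)
    (natDegree_linear_le.trans_lt hWd)
  have coeff_one := congrArg (coeff · 1) zero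
  have coeff_zero := congrArg (coeff · 0) zero
  simp only [coeff_add, coeff_C_mul, coeff_X_one, coeff_X_zero, coeff_C_zero, coeff_C_succ,
    mul_one, mul_zero, add_zero, zero_add, Polynomial.coeff_zero,
    sub_eq_zero] at coeff_one coeff_zero
  exact Line.ext coeff_one coeff_zero

theorem coeff_zero_ne_zero_of_irreducible {W : F[X]} (hW : Irreducible W)
    (hWd : 1 < W.natDegree) : W.coeff 0 ≠ 0 := by
  intro h
  have associated := irreducible_X.associated_of_dvd hW (X_dvd_iff.2 h)
  rw [← natDegree_eq_of_degree_eq (degree_eq_degree_of_associated associated), natDegree_X] at hWd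
  exact lt_irrefl 1 hWd

theorem solveSystem_eq_some {W : F[X]} {S : F[X] × F[X]} (hi : Irreducible W) (hW : W.Monic)
    (hWd : W.natDegree = 3) (h1 : S.1.natDegree ≤ 4) (h2 : S.2.Monic) (h2d : S.2.natDegree = 3)
    (hne : W ≠ S.2) {L : Line F} (hL : W ∣ S.1 + (C L.a₁ * X + C L.a₀) * S.2) :
    solveSystem W S = some L := by
  have one_lt : 1 < W.natDegree := by omega
  have iff_dvd :=
    solvesSystem_iff_dvd hW hWd (coeff_zero_ne_zero_of_irreducible hi one_lt) h1 h2 h2d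
  have not_dvd : ¬W ∣ S.2 := fun hd =>
    hne (eq_of_monic_of_dvd_of_natDegree_le hW h2 hd (by omega)).symm
  have unique (L') (h' : SolvesSystem W S L') : L' = L :=
    line_eq_of_dvd hi one_lt not_dvd ((iff_dvd L').1 h') hL
  have exists_unique : ∃! L', SolvesSystem W S L' := ⟨L, (iff_dvd L).2 hL, unique⟩
  rw [solveSystem, dif_pos exists_unique, unique _ exists_unique.choose_spec.1]

end LinearSystem

theorem eq_of_irreducible_of_monic_of_dvd {F : Type*} [Field F] {W V : F[X]} (hW : Irreducible W)
    (hV : Irreducible V) (mW : W.Monic) (mV : V.Monic) (h : W ∣ V) : W = V :=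
  eq_of_monic_of_associated mW mV (hW.associated_of_dvd hV h)

theorem toMonic_eq_of_dvd {F : Type*} [Field F] {W G : F[X]} (hW : W.Monic) (hG : G ≠ 0)
    (hWG : W ∣ G) (h : G.natDegree ≤ W.natDegree) : toMonic G = W := by
  have leadingCoeff_ne_zero := leadingCoeff_ne_zero.2 hG
  refine eq_of_monic_of_dvd_of_natDegree_le hW
    (monic_C_mul_of_mul_leadingCoeff_eq_one (inv_mul_cancel₀ leadingCoeff_ne_zero))
    (hWG.mul_left _) ?_
  rwa [toMonic, natDegree_C_mul (inv_ne_zero leadingCoeff_ne_zero)]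

section TraceZeroParam

variable {F : Type*} [Field F] [Fintype F] {K : Type*} [Field K] [DecidableEq K] [Algebra F K]
  {A B : F} {R : Type*} [CommRing R] {s : R} {pt : R →+ Points K A B}

/-- `S = S₁ + y S₂` has the degrees of the generic `S_{Q,R}`, and all irreducible factors of
`f S₂² - S₁²` come from zeros of `S` in the parametrized group. -/
structure GoodPair (pt : R →+ Points K A B) (S : F[X] × F[X]) : Prop where
  natDegree_le : S.1.natDegree ≤ 4
  monic : S.2.Monic
  natDegree_eq : S.2.natDegree = 3
  exists_zero : ∀ W : F[X], Irreducible W → W.Monic → W ∣ sigma A B S →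
    ∃ z, z ≠ 0 ∧ VanishesAt S (pt z) ∧ W = minX pt z

namespace TraceZeroParam

theorem minX_eq_of_dvd (H : TraceZeroParam s pt) {a b : R} (h : minX pt a ∣ minX pt b) :
    minX pt a = minX pt b :=
  eq_of_irreducible_of_monic_of_dvd (H.irreducible_minX a) (H.irreducible_minX b)
    (H.monic_minX a) (H.monic_minX b) h

theorem isCoprime_minX (H : TraceZeroParam s pt) {a b : R} (h : minX pt a ≠ minX pt b) :
    IsCoprime (minX pt a) (minX pt b) :=
  (H.irreducible_minX a).coprime_iff_not_dvd.2 fun hd => h (H.minX_eq_of_dvd hd)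

theorem eq_minX_of_dvd_mul (H : TraceZeroParam s pt) {u v w : R} {W : F[X]} (hi : Irreducible W)
    (hW : W.Monic) (h : W ∣ minX pt u * minX pt v * minX pt w) :
    W = minX pt u ∨ W = minX pt v ∨ W = minX pt w := by
  have eq_of_dvd {c : R} : W ∣ minX pt c → W = minX pt c :=
    eq_of_irreducible_of_monic_of_dvd hi (H.irreducible_minX c) hW (H.monic_minX c)
  rw [hi.prime.dvd_mul, hi.prime.dvd_mul, or_assoc] at h
  exact h.imp eq_of_dvd (.imp eq_of_dvd eq_of_dvd)

theorem minX_dvd_sigma (H : TraceZeroParam s pt) {S : F[X] × F[X]} {a : R} (ha : a ≠ 0)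
    (h : VanishesAt S (pt a)) : minX pt a ∣ sigma A B S :=
  h.minpoly_dvd_sigma (H.pt_ne_zero ha)

variable [IsDomain R]

theorem sq_minX_dvd_sigma (H : TraceZeroParam s pt) {S : F[X] × F[X]} {a : R} (ha : a ≠ 0)
    (h : VanishesAt S (pt a)) (h' : VanishesAt S (pt (-a))) : minX pt a ^ 2 ∣ sigma A B S := by
  have dvd_snd : minX pt a ∣ S.2 :=
    minpoly_dvd_snd_of_vanishesAt_neg H.two_ne_zero (H.yCoord_ne_zero ha) h (by rwa [← map_neg])
  have dvd_fst : minX pt a ∣ S.1 := by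
    rw [VanishesAt, minpoly.dvd_iff.1 dvd_snd, mul_zero, add_zero] at h
    exact minpoly.dvd F _ h
  exact dvd_sub ((pow_dvd_pow_of_dvd dvd_snd 2).mul_left _) (pow_dvd_pow_of_dvd dvd_fst 2)

theorem minX_mul_minX_dvd_sigma (H : TraceZeroParam s pt) {S : F[X] × F[X]} {u v : R} (hu : u ≠ 0)
    (hv : v ≠ 0) (Vu : VanishesAt S (pt u)) (Vv : VanishesAt S (pt v)) (huv : ¬Conj s u v) :
    minX pt u * minX pt v ∣ sigma A B S := by
  by_cases e : minX pt u = minX pt v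
  · have conj_neg := (H.conj_or_of_minX_eq hu hv e).resolve_left huv
    rw [e, ← sq]
    exact H.sq_minX_dvd_sigma hv Vv (H.vanishesAt_of_conj Vu conj_neg)
  · exact (H.isCoprime_minX e).mul_dvd (H.minX_dvd_sigma hu Vu) (H.minX_dvd_sigma hv Vv)

theorem minX_ne_of_eq (H : TraceZeroParam s pt) {u v w : R} (hu : u ≠ 0) (hv : v ≠ 0) (hw : w ≠ 0)
    (huv : ¬Conj s u v) (huw : ¬Conj s u w) (hvw : ¬Conj s v w) (e : minX pt u = minX pt v) :
    minX pt u ≠ minX pt w := by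
  intro e'
  have conj_neg_v := (H.conj_or_of_minX_eq hu hv e).resolve_left huv
  have conj_neg_w := (H.conj_or_of_minX_eq hu hw e').resolve_left huw
  exact hvw (by simpa using ((H.conj_symm conj_neg_v).trans conj_neg_w).neg)

theorem minX_mul_minX_mul_minX_dvd_sigma (H : TraceZeroParam s pt) {S : F[X] × F[X]} {u v w : R}
    (hu : u ≠ 0) (hv : v ≠ 0) (hw : w ≠ 0) (Vu : VanishesAt S (pt u)) (Vv : VanishesAt S (pt v))
    (Vw : VanishesAt S (pt w)) (huv : ¬Conj s u v) (huw : ¬Conj s u w) (hvw : ¬Conj s v w) :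
    minX pt u * minX pt v * minX pt w ∣ sigma A B S := by
  by_cases uw : minX pt u = minX pt w
  · have uv := H.minX_ne_of_eq hu hw hv huw huv (hvw <| H.conj_symm ·) uw
    rw [mul_right_comm]
    exact ((H.isCoprime_minX uv).mul_left (H.isCoprime_minX (uw ▸ uv))).mul_dvd
      (H.minX_mul_minX_dvd_sigma hu hw Vu Vw huw) (H.minX_dvd_sigma hv Vv)
  by_cases vw : minX pt v = minX pt w
  · rw [mul_assoc]
    exact ((H.isCoprime_minX (vw ▸ uw)).mul_right (H.isCoprime_minX uw)).mul_dvd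
      (H.minX_dvd_sigma hu Vu) (H.minX_mul_minX_dvd_sigma hv hw Vv Vw hvw)
  · exact ((H.isCoprime_minX uw).mul_left (H.isCoprime_minX vw)).mul_dvd
      (H.minX_mul_minX_dvd_sigma hu hv Vu Vv huv) (H.minX_dvd_sigma hw Vw)

theorem sigma_eq_mul (H : TraceZeroParam s pt) {S : F[X] × F[X]} (h1 : S.1.natDegree ≤ 4)
    (h2 : S.2.Monic) (h3 : S.2.natDegree = 3) {u v w : R} (hu : u ≠ 0) (hv : v ≠ 0) (hw : w ≠ 0)
    (Vu : VanishesAt S (pt u)) (Vv : VanishesAt S (pt v)) (Vw : VanishesAt S (pt w))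
    (huv : ¬Conj s u v) (huw : ¬Conj s u w) (hvw : ¬Conj s v w) :
    sigma A B S = minX pt u * minX pt v * minX pt w := by
  have monic := (H.monic_minX u).mul (H.monic_minX v)
  refine eq_of_monic_of_dvd_of_natDegree_le (monic.mul (H.monic_minX w)) (monic_sigma h1 h2 h3)
    (H.minX_mul_minX_mul_minX_dvd_sigma hu hv hw Vu Vv Vw huv huw hvw) ?_
  rw [natDegree_sigma h1 h2 h3, monic.natDegree_mul (H.monic_minX w),
    (H.monic_minX u).natDegree_mul (H.monic_minX v), H.natDegree_minX hu, H.natDegree_minX hv,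
    H.natDegree_minX hw]

theorem conj_of_minX_eq_of_sigma_eq (H : TraceZeroParam s pt) {S : F[X] × F[X]} {u v w c : R}
    (hu : u ≠ 0) (hv : v ≠ 0) (hw : w ≠ 0) (hc : c ≠ 0) (Vu : VanishesAt S (pt u))
    (Vc : VanishesAt S (pt c)) (huv : ¬Conj s u v) (huw : ¬Conj s u w)
    (sigma_eq : sigma A B S = minX pt u * minX pt v * minX pt w) (e : minX pt c = minX pt u) :
    Conj s u c ∨ Conj s v c ∨ Conj s w c := by
  rcases H.conj_or_of_minX_eq hu hc e.symm with h | h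
  · exact .inl h
  have conj_neg : Conj s c (-u) := by simpa using (H.conj_symm h).neg
  have sq_dvd := H.sq_minX_dvd_sigma hu Vu (H.vanishesAt_of_conj Vc conj_neg)
  rw [sigma_eq, mul_assoc, sq, mul_dvd_mul_iff_left (H.irreducible_minX u).ne_zero] at sq_dvd
  have conj_of_dvd {z : R} (hz : z ≠ 0) (huz : ¬Conj s u z) (hd : minX pt u ∣ minX pt z) :
      Conj s z c := by
    have := (H.conj_or_of_minX_eq hu hz (H.minX_eq_of_dvd hd)).resolve_left huz
    simpa using ((H.conj_symm this).trans h).neg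
  exact .inr (((H.irreducible_minX u).prime.dvd_or_dvd sq_dvd).imp (conj_of_dvd hv huv)
    (conj_of_dvd hw huw))

theorem conj_of_vanishesAt_of_sigma_eq (H : TraceZeroParam s pt) {S : F[X] × F[X]} {u v w c : R}
    (hu : u ≠ 0) (hv : v ≠ 0) (hw : w ≠ 0) (hc : c ≠ 0) (Vu : VanishesAt S (pt u))
    (Vv : VanishesAt S (pt v)) (Vw : VanishesAt S (pt w)) (Vc : VanishesAt S (pt c))
    (huv : ¬Conj s u v) (huw : ¬Conj s u w) (hvw : ¬Conj s v w)
    (sigma_eq : sigma A B S = minX pt u * minX pt v * minX pt w) :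
    Conj s u c ∨ Conj s v c ∨ Conj s w c := by
  have hvu := fun h => huv (H.conj_symm h)
  have hwu := fun h => huw (H.conj_symm h)
  have hwv := fun h => hvw (H.conj_symm h)
  rcases H.eq_minX_of_dvd_mul (H.irreducible_minX c) (H.monic_minX c)
    (sigma_eq ▸ H.minX_dvd_sigma hc Vc) with e | e | e
  · exact H.conj_of_minX_eq_of_sigma_eq hu hv hw hc Vu Vc huv huw sigma_eq e
  · have := H.conj_of_minX_eq_of_sigma_eq hv hu hw hc Vv Vc hvu hvw
      (sigma_eq.trans (by ring)) e
    tauto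
  · have := H.conj_of_minX_eq_of_sigma_eq hw hu hv hc Vw Vc hwu hwv
      (sigma_eq.trans (by ring)) e
    tauto

section SPoly

variable {a b : R} {L L' : Line F}

theorem vanishesAt_sPoly (H : TraceZeroParam s pt) (h : IsLineOf L (pt a))
    (h' : IsLineOf L' (pt b)) (hab : ¬Conj s a (-b)) (i : ℕ) :
    VanishesAt (sPoly A B L L') (pt (a + s ^ i * b)) := by
  rw [map_add]
  refine h.vanishesAt_sPoly (H.isLineOf_of_conj h' ⟨i, rfl⟩) ?_
  rw [← map_add]
  exact H.pt_ne_zero (H.add_pow_mul_ne_zero hab i)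

theorem not_conj_add_pow_mul (H : TraceZeroParam s pt) (ha : a ≠ 0) (hb : b ≠ 0)
    (hab : ¬Conj s a b) :
    ¬Conj s (a + s ^ 0 * b) (a + s ^ 1 * b) ∧ ¬Conj s (a + s ^ 0 * b) (a + s ^ 2 * b) ∧
      ¬Conj s (a + s ^ 1 * b) (a + s ^ 2 * b) := by
  refine ⟨H.not_conj_add_pow_mul_succ ha hb hab 0, fun h => ?_,
    H.not_conj_add_pow_mul_succ ha hb hab 1⟩
  refine H.not_conj_add_pow_mul_succ ha hb hab 2 ?_
  rw [H.cube_eq_one, ← pow_zero s]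
  exact H.conj_symm h

theorem sigma_sPoly (H : TraceZeroParam s pt) (h : IsLineOf L (pt a)) (h' : IsLineOf L' (pt b))
    (hab : ¬Conj s a b) (hab' : ¬Conj s a (-b)) :
    sigma A B (sPoly A B L L') =
      minX pt (a + s ^ 0 * b) * minX pt (a + s ^ 1 * b) * minX pt (a + s ^ 2 * b) := by
  have sB3_ne_zero := H.sB3_ne_zero h h' hab'
  have ne_zero := H.add_pow_mul_ne_zero hab'
  have vanishesAt := H.vanishesAt_sPoly h h' hab'
  obtain ⟨n01, n02, n12⟩ :=
    H.not_conj_add_pow_mul (ne_zero_of_isLineOf h) (ne_zero_of_isLineOf h') hab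
  exact H.sigma_eq_mul (natDegree_sPoly_fst_le A B L L') (monic_sPoly_snd sB3_ne_zero)
    (natDegree_sPoly_snd sB3_ne_zero) (ne_zero 0) (ne_zero 1) (ne_zero 2) (vanishesAt 0)
    (vanishesAt 1) (vanishesAt 2) n01 n02 n12

theorem goodPair_sPoly (H : TraceZeroParam s pt) (h : IsLineOf L (pt a))
    (h' : IsLineOf L' (pt b)) (hab : ¬Conj s a b) (hab' : ¬Conj s a (-b)) :
    GoodPair pt (sPoly A B L L') where
  natDegree_le := natDegree_sPoly_fst_le A B L L'
  monic := monic_sPoly_snd (H.sB3_ne_zero h h' hab')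
  natDegree_eq := natDegree_sPoly_snd (H.sB3_ne_zero h h' hab')
  exists_zero W hi hW hWd := by
    have ne_zero := H.add_pow_mul_ne_zero hab'
    have vanishesAt := H.vanishesAt_sPoly h h' hab'
    rcases H.eq_minX_of_dvd_mul hi hW (H.sigma_sPoly h h' hab hab' ▸ hWd) with e | e | e
    exacts [⟨_, ne_zero 0, vanishesAt 0, e⟩, ⟨_, ne_zero 1, vanishesAt 1, e⟩,
      ⟨_, ne_zero 2, vanishesAt 2, e⟩]

theorem isConjSum_of_vanishesAt_sPoly (H : TraceZeroParam s pt) (h : IsLineOf L (pt a))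
    (h' : IsLineOf L' (pt b)) (hab : ¬Conj s a b) (hab' : ¬Conj s a (-b)) {c : R} (hc : c ≠ 0)
    (Vc : VanishesAt (sPoly A B L L') (pt c)) :
    IsConjSum s a b c := by
  have ne_zero := H.add_pow_mul_ne_zero hab'
  have vanishesAt := H.vanishesAt_sPoly h h' hab'
  obtain ⟨n01, n02, n12⟩ :=
    H.not_conj_add_pow_mul (ne_zero_of_isLineOf h) (ne_zero_of_isLineOf h') hab
  simpa only [isConjSum_iff_of_cube_eq_one H.cube_eq_one, pow_zero, one_mul, pow_one] using
    H.conj_of_vanishesAt_of_sigma_eq (ne_zero 0) (ne_zero 1) (ne_zero 2) hc (vanishesAt 0)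
      (vanishesAt 1) (vanishesAt 2) Vc n01 n02 n12 (H.sigma_sPoly h h' hab hab')

theorem sA3_neg_ne_zero (H : TraceZeroParam s pt) (h : IsLineOf L (pt a)) :
    sA3 A B L.a₁ L.a₀ (-L.a₁) (-L.a₀) ≠ 0 := by
  have ne := H.xCoord_pow_ne (ne_zero_of_isLineOf h)
  have ne_sq := pow_card_sq_ne H.finrank_eq ne
  have pow_ne : xCoord (pt a) ^ Fintype.card F ≠ xCoord (pt a) ^ Fintype.card F ^ 2 := by
    rw [sq, pow_mul]
    exact fun e => ne (pow_card_injective (F := F) e).symm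
  rw [← (algebraMap F K).injective.ne_iff, map_zero, map_sA3, map_neg, map_neg,
    sA3_neg_eq h.isIntersection]
  exact neg_ne_zero.2 (pow_ne_zero _ (mul_ne_zero (mul_ne_zero (sub_ne_zero.2 ne.symm)
    (sub_ne_zero.2 ne_sq.symm)) (sub_ne_zero.2 pow_ne)))

theorem toMonic_sPoly_neg (H : TraceZeroParam s pt) (h : IsLineOf L (pt a))
    (h' : IsLineOf L.neg (pt b)) (hab : a + b ≠ 0) :
    toMonic (sPoly A B L L.neg).1 = minX pt (a + b) := by
  have natDegree_eq := natDegree_sPoly_neg_fst (H.sA3_neg_ne_zero h)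
  have vanishesAt := h.vanishesAt_sPoly h' (by simpa only [map_add] using H.pt_ne_zero hab)
  rw [VanishesAt, sPoly_neg_snd, map_zero, mul_zero, add_zero, ← map_add] at vanishesAt
  refine toMonic_eq_of_dvd (H.monic_minX _) (fun h0 => ?_) (minpoly.dvd F _ vanishesAt) ?_
  · rw [h0, natDegree_zero] at natDegree_eq
    exact absurd natDegree_eq (by norm_num)
  · rw [natDegree_eq, H.natDegree_minX hab]

end SPoly

end TraceZeroParam

end TraceZeroParam

theorem mem_cubicFactors {F : Type*} [Field F] {G W : F[X]} (hG : G ≠ 0) :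
    W ∈ cubicFactors G ↔ Irreducible W ∧ W.Monic ∧ W ∣ G ∧ W.natDegree = 3 := by
  classical
  rw [cubicFactors, Finset.mem_filter, Multiset.mem_toFinset,
    UniqueFactorizationMonoid.mem_normalizedFactors_iff' hG]
  constructor
  · rintro ⟨⟨hi, hn, hd⟩, natDegree_eq⟩
    exact ⟨hi, hn ▸ monic_normalize hi.ne_zero, hd, natDegree_eq⟩
  · rintro ⟨hi, hm, hd, natDegree_eq⟩
    exact ⟨⟨hi, hm.normalize_eq_self, hd⟩, natDegree_eq⟩

theorem Line.neg_neg {F : Type*} [Field F] (L : Line F) : L.neg.neg = L := by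
  simp only [Line.neg, _root_.neg_neg]

namespace TraceZeroParam

variable {F : Type*} [Field F] [Fintype F] {K : Type*} [Field K] [DecidableEq K] [Algebra F K]
  {A B : F} {R : Type*} [CommRing R] {s : R} {pt : R →+ Points K A B}

theorem isConjSum_neg_add (H : TraceZeroParam s pt) {a b : R} (h : Conj s a (-b))
    (hab : a + b ≠ 0) : IsConjSum s a b (-(a + b)) := by
  rcases (conj_iff_of_cube_eq_one H.cube_eq_one).1 h with h | h | h
  · exact absurd (by linear_combination -h) hab
  · obtain rfl : b = -(s * a) := by linear_combination -h
    exact ⟨1, 2, by linear_combination a * H.cube_eq_one⟩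
  · obtain rfl : b = -(s ^ 2 * a) := by linear_combination -h
    exact ⟨2, 1, by linear_combination a * H.cube_eq_one⟩

variable [IsDomain R]

theorem isLineOf_neg_add (H : TraceZeroParam s pt) {a b : R} {L : Line F}
    (ha : IsLineOf L (pt a)) (hb : IsLineOf L (pt b)) (hab : a ≠ b) :
    IsLineOf L.neg (pt (a + b)) := by
  refine H.isLineOf_of_conj (H.isLineOf_neg ha) ?_
  rcases (conj_iff_of_cube_eq_one H.cube_eq_one).1 (H.conj_of_isLineOf ha hb) with rfl | rfl | rfl
  · exact absurd rfl hab
  · exact ⟨2, by linear_combination a * H.rel⟩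
  · exact ⟨1, by linear_combination a * H.rel⟩

section Factors

variable {S T : F[X] × F[X]} {t : R} {L : Line F}

theorem solveSystem_minX (H : TraceZeroParam s pt) (gS : GoodPair pt S)
    (hL : IsLineOf L (pt t)) (V : VanishesAt S (pt t)) (hne : minX pt t ≠ S.2) :
    solveSystem (minX pt t) S = some L :=
  solveSystem_eq_some (H.irreducible_minX t) (H.monic_minX t)
    (H.natDegree_minX (ne_zero_of_isLineOf hL)) gS.natDegree_le gS.monic gS.natDegree_eq hne
    (hL.minpoly_dvd_iff.2 V)

theorem minX_eq_snd_iff (H : TraceZeroParam s pt) (gS : GoodPair pt S) (ht : t ≠ 0)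
    (V : VanishesAt S (pt t)) : minX pt t = S.2 ↔ VanishesAt S (pt (-t)) := by
  constructor
  · intro e
    have snd_eq_zero : aeval (xCoord (pt t)) S.2 = 0 := by
      rw [← e]
      exact minpoly.aeval F _
    unfold VanishesAt at *
    rw [map_neg, xCoord_neg, yCoord_neg, snd_eq_zero, mul_zero, add_zero]
    rwa [snd_eq_zero, mul_zero, add_zero] at V
  · intro V'
    refine (eq_of_monic_of_dvd_of_natDegree_le (H.monic_minX t) gS.monic
      (minpoly_dvd_snd_of_vanishesAt_neg H.two_ne_zero (H.yCoord_ne_zero ht) V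
        (by rwa [← map_neg])) ?_).symm
    rw [gS.natDegree_eq, H.natDegree_minX ht]

theorem minX_ne_snd_of_forall_conj (H : TraceZeroParam s pt) (gT : GoodPair pt T) (ht : t ≠ 0)
    (hC : ∀ z, z ≠ 0 → VanishesAt S (pt z) → VanishesAt T (pt z) → Conj s t z)
    (VS : VanishesAt S (pt (-t))) (VT : VanishesAt T (pt t)) : minX pt t ≠ T.2 := fun e =>
  H.not_conj_neg ht (hC _ (neg_ne_zero.2 ht) VS ((H.minX_eq_snd_iff gT ht VT).1 e))

/-- If `W = S₂`, both points above each root of `W` are zeros of `S`, so that the zeros of `T` there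
are common zeros. -/
theorem solveSystem_snd (H : TraceZeroParam s pt) (gS : GoodPair pt S) (gT : GoodPair pt T)
    (hL : IsLineOf L (pt t))
    (hC : ∀ z, z ≠ 0 → VanishesAt S (pt z) → VanishesAt T (pt z) → Conj s t z)
    (VS : VanishesAt S (pt t)) (VT : VanishesAt T (pt t)) {z : R} (hz : z ≠ 0)
    (Vz : VanishesAt S (pt z)) (e : minX pt z = S.2) (dvd : minX pt z ∣ sigma A B T) :
    solveSystem (minX pt z) T = some L := by
  have ht := ne_zero_of_isLineOf hL
  obtain ⟨z', hz', Vz', e'⟩ := gT.exists_zero _ (H.irreducible_minX z) (H.monic_minX z) dvd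
  have VS' : VanishesAt S (pt z') := by
    rcases H.conj_or_of_minX_eq hz hz' e' with h | h
    · exact H.vanishesAt_of_conj Vz h
    · exact H.vanishesAt_of_conj ((H.minX_eq_snd_iff gS hz Vz).1 e) (by simpa using h.neg)
  rw [e', H.minX_eq_of_conj (hC z' hz' VS' Vz')] at e ⊢
  exact H.solveSystem_minX gT hL VT
    (H.minX_ne_snd_of_forall_conj gT ht hC ((H.minX_eq_snd_iff gS ht VS).1 e) VT)

theorem factorLoop_eq_some (H : TraceZeroParam s pt) (h2 : ringChar F ≠ 2)
    (gS : GoodPair pt S) (gT : GoodPair pt T) (hL : IsLineOf L (pt t))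
    (hC : ∀ z, z ≠ 0 → VanishesAt S (pt z) → VanishesAt T (pt z) → Conj s t z)
    (VS : VanishesAt S (pt t)) (VT : VanishesAt T (pt t)) {l : List F[X]}
    (hl : ∀ W ∈ l, Irreducible W ∧ W.Monic ∧ W ∣ sigma A B S ∧ W ∣ sigma A B T)
    (ht : minX pt t ∈ l) : factorLoop S T l = some L := by
  induction l with
  | nil => exact absurd ht List.not_mem_nil
  | cons W l ih =>
    obtain ⟨Wi, Wm, WS, WT⟩ := hl W List.mem_cons_self
    obtain ⟨z, hz, Vz, rfl⟩ := gS.exists_zero W Wi Wm WS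
    rw [factorLoop]
    by_cases e : minX pt z = S.2
    · rw [if_neg (not_not.2 e)]
      exact H.solveSystem_snd gS gT hL hC VS VT hz Vz e WT
    obtain ⟨L', hL'⟩ := H.exists_isLineOf hz
    rw [if_pos e, H.solveSystem_minX gS hL' Vz e]
    dsimp only
    rw [add_comm, hL'.minpoly_dvd_iff]
    split_ifs with Vz'
    · rw [H.isLineOf_unique h2 hL hL' (hC z hz Vz Vz')]
    · refine ih (fun W hW => hl W (List.mem_cons_of_mem _ hW))
        ((List.mem_cons.1 ht).resolve_left fun et => ?_)
      rcases H.conj_or_of_minX_eq (ne_zero_of_isLineOf hL) hz et with h | h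
      · exact Vz' (H.vanishesAt_of_conj VT h)
      · exact e ((H.minX_eq_snd_iff gS hz Vz).2 (H.vanishesAt_of_conj VS h))

end Factors

section Subalgorithm

variable {a b c d : R} {L M₁ M₂ N₁ N₂ : Line F}

theorem solveSystem_sPoly_neg (H : TraceZeroParam s pt) (ha : IsLineOf M₁ (pt a))
    (hb : IsLineOf M₁.neg (pt b)) (hc : IsLineOf N₁ (pt c)) (hd : IsLineOf N₂ (pt d))
    (hcd : ¬Conj s c d) (hsum : a + b = c + d)
    (hC : ∀ z, IsConjSum s a b z → IsConjSum s c d z → Conj s (a + b) z)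
    (hL : IsLineOf L (pt (a + b))) :
    solveSystem (toMonic (sPoly A B M₁ M₁.neg).1) (sPoly A B N₁ N₂) = some L := by
  have h0 := ne_zero_of_isLineOf hL
  have conj_neg : Conj s a (-b) := by
    simpa only [Line.neg_neg] using H.conj_of_isLineOf ha (Line.neg_neg M₁ ▸ H.isLineOf_neg hb)
  have not_isConjSum : ¬IsConjSum s c d (-(a + b)) := fun h =>
    H.not_conj_neg h0 (hC _ (H.isConjSum_neg_add conj_neg h0) h)
  have hcd' : ¬Conj s c (-d) := fun h =>
    not_isConjSum (hsum ▸ H.isConjSum_neg_add h (hsum ▸ h0))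
  have good := H.goodPair_sPoly hc hd hcd hcd'
  have vanishesAt : VanishesAt (sPoly A B N₁ N₂) (pt (a + b)) := by
    simpa only [hsum, pow_zero, one_mul] using H.vanishesAt_sPoly hc hd hcd' 0
  rw [H.toMonic_sPoly_neg ha hb h0]
  refine H.solveSystem_minX good hL vanishesAt fun e => not_isConjSum ?_
  exact H.isConjSum_of_vanishesAt_sPoly hc hd hcd hcd' (neg_ne_zero.2 h0)
    ((H.minX_eq_snd_iff good h0 vanishesAt).1 e)

theorem factorLoop_sPoly (H : TraceZeroParam s pt) (h2 : ringChar F ≠ 2)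
    {enum : Finset F[X] → List F[X]} (henum : ∀ Z : Finset F[X], (enum Z : Multiset F[X]) = Z.val)
    (ha : IsLineOf M₁ (pt a)) (hb : IsLineOf M₂ (pt b)) (hc : IsLineOf N₁ (pt c))
    (hd : IsLineOf N₂ (pt d)) (hab : ¬Conj s a b) (hab' : ¬Conj s a (-b)) (hcd : ¬Conj s c d)
    (hcd' : ¬Conj s c (-d)) (hsum : a + b = c + d)
    (hC : ∀ z, IsConjSum s a b z → IsConjSum s c d z → Conj s (a + b) z)
    (hL : IsLineOf L (pt (a + b))) [DecidableEq F[X]] :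
    factorLoop (sPoly A B M₁ M₂) (sPoly A B N₁ N₂) (enum (cubicFactors (EuclideanDomain.gcd
      (sigma A B (sPoly A B M₁ M₂)) (sigma A B (sPoly A B N₁ N₂))))) = some L := by
  have h0 := ne_zero_of_isLineOf hL
  have gS := H.goodPair_sPoly ha hb hab hab'
  have gT := H.goodPair_sPoly hc hd hcd hcd'
  have VS : VanishesAt (sPoly A B M₁ M₂) (pt (a + b)) := by
    simpa only [pow_zero, one_mul] using H.vanishesAt_sPoly ha hb hab' 0
  have VT : VanishesAt (sPoly A B N₁ N₂) (pt (a + b)) := by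
    simpa only [hsum, pow_zero, one_mul] using H.vanishesAt_sPoly hc hd hcd' 0
  have gcd_ne_zero :
      EuclideanDomain.gcd (sigma A B (sPoly A B M₁ M₂)) (sigma A B (sPoly A B N₁ N₂)) ≠ 0 :=
    fun h => (monic_sigma gS.natDegree_le gS.monic gS.natDegree_eq).ne_zero
      (EuclideanDomain.gcd_eq_zero_iff.1 h).1
  have mem_enum (Z : Finset F[X]) (W : F[X]) : W ∈ enum Z ↔ W ∈ Z := by
    rw [← Multiset.mem_coe, henum, Finset.mem_val]
  refine H.factorLoop_eq_some h2 gS gT hL (fun z hz Vz Vz' => hC z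
    (H.isConjSum_of_vanishesAt_sPoly ha hb hab hab' hz Vz)
    (H.isConjSum_of_vanishesAt_sPoly hc hd hcd hcd' hz Vz')) VS VT (fun W hW => ?_) ?_
  · obtain ⟨hi, hm, dvd, -⟩ := (mem_cubicFactors gcd_ne_zero).1 ((mem_enum _ _).1 hW)
    exact ⟨hi, hm, dvd.trans (EuclideanDomain.gcd_dvd_left _ _),
      dvd.trans (EuclideanDomain.gcd_dvd_right _ _)⟩
  · exact (mem_enum _ _).2 ((mem_cubicFactors gcd_ne_zero).2 ⟨H.irreducible_minX _,
      H.monic_minX _, EuclideanDomain.dvd_gcd (H.minX_dvd_sigma h0 VS) (H.minX_dvd_sigma h0 VT),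
      H.natDegree_minX h0⟩)

theorem subalg_eq_some (H : TraceZeroParam s pt) (h2 : ringChar F ≠ 2)
    {enum : Finset F[X] → List F[X]} (henum : ∀ Z : Finset F[X], (enum Z : Multiset F[X]) = Z.val)
    (ha : IsLineOf M₁ (pt a)) (hb : IsLineOf M₂ (pt b)) (hc : IsLineOf N₁ (pt c))
    (hd : IsLineOf N₂ (pt d)) (hsum : a + b = c + d) (h0 : a + b ≠ 0) (hab : a ≠ b) (hcd : c ≠ d)
    (hC : ∀ z, IsConjSum s a b z → IsConjSum s c d z → Conj s (a + b) z) :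
    ∃ L : Line F, subalg enum A B M₁ M₂ N₁ N₂ = some L ∧ IsLineOf L (pt (a + b)) := by
  obtain ⟨L, hL⟩ := H.exists_isLineOf h0
  rw [subalg]
  split_ifs with eM eN eM' eN'
  · exact ⟨_, rfl, H.isLineOf_neg_add ha (eM ▸ hb) hab⟩
  · exact ⟨_, rfl, hsum ▸ H.isLineOf_neg_add hc (eN ▸ hd) hcd⟩
  all_goals
    have hab : ¬Conj s a b := fun h => eM (H.isLineOf_unique h2 ha hb h)
    have hcd : ¬Conj s c d := fun h => eN (H.isLineOf_unique h2 hc hd h)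
    refine ⟨L, ?_, hL⟩
  · obtain rfl : M₂ = M₁.neg := by rw [eM', Line.neg_neg]
    exact H.solveSystem_sPoly_neg ha hb hc hd hcd hsum hC hL
  · obtain rfl : N₂ = N₁.neg := by rw [eN', Line.neg_neg]
    rw [hsum] at hC hL
    exact H.solveSystem_sPoly_neg hc hd ha hb hab hsum.symm (fun z h h' => hC z h' h) hL
  · have hab' : ¬Conj s a (-b) := fun h => eM' (H.isLineOf_unique h2 ha (H.isLineOf_neg hb) h)
    have hcd' : ¬Conj s c (-d) := fun h => eN' (H.isLineOf_unique h2 hc (H.isLineOf_neg hd) h)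
    classical
    exact H.factorLoop_sPoly h2 henum ha hb hc hd hab hab' hcd hcd' hsum hC hL

end Subalgorithm

end TraceZeroParam

theorem intCast_zmod_ne_zero {p : ℕ} {n : ℤ} (h0 : n ≠ 0) (h : n.natAbs < p) :
    (n : ZMod p) ≠ 0 := fun e =>
  h.not_ge (Nat.le_of_dvd (Int.natAbs_pos.2 h0)
    (Int.natCast_dvd.1 ((ZMod.intCast_zmod_eq_zero_iff_dvd n p).1 e)))

/-- The ring of Eisenstein integers `ℤ[ω]`, where `ω² + ω + 1 = 0`. Linear relations with small
coefficients between conjugates in `ℤ/p` are tested in it. -/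
abbrev Eisenstein : Type := QuadraticAlgebra ℤ (-1) (-1)

namespace Eisenstein

/-- The powers `1, ω, ω²`. -/
def root : Fin 3 → Eisenstein := ![⟨1, 0⟩, ⟨0, 1⟩, ⟨-1, -1⟩]

/-- The pairs `(α, β)` for which `α / β`, with `ω` replaced by `s`, is an exceptional residue. -/
def fractions : Fin 6 → Eisenstein × Eisenstein :=
  ![(⟨3, 0⟩, ⟨1, 2⟩), (⟨-3, 0⟩, ⟨1, 2⟩), (⟨-4, 1⟩, ⟨0, 3⟩), (⟨-1, 4⟩, ⟨1, 2⟩), (⟨5, 1⟩, ⟨3, 3⟩),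
    (⟨5, 4⟩, ⟨1, 2⟩)]

/-- The pairs of constant multiples of `P` in the four special cases of the ladder. -/
def shifts : Fin 4 → ℤ × ℤ := ![(3, 7), (3, -5), (-3, 5), (-3, -7)]

/-- The nonzero elements of norm at most `3303`, the largest norm that is needed in
`eq_root_mul_fractions_or_small`. No prime `p > 3303` divides the norm of such an element, so that
its image in `ℤ/p` is not zero. -/
def Small (z : Eisenstein) : Prop := 0 < z.norm ∧ z.norm ≤ 3303

instance (z : Eisenstein) : Decidable (Small z) := inferInstanceAs (Decidable (_ ∧ _))

theorem small_snd_fractions : ∀ k, Small (fractions k).2 := by decide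

theorem small_mul_fractions_sub : ∀ n ∈ Finset.Icc (-14 : ℤ) 14, ∀ k,
    Small (n * (fractions k).2 - (fractions k).1) := by decide

set_option maxRecDepth 100000 in
/-- With `α, β` scaled to `β = 1`: a conjugate sum of `m` and `α - m` is conjugate to one of `n` and
`α - n` only if it is conjugate to `α`, up to primes of small norm. -/
theorem eq_root_mul_fractions_or_small : ∀ k c i j l,
    let m := (shifts c).1 * (fractions k).2 +
      root i * ((fractions k).1 - (shifts c).1 * (fractions k).2)
    let z := m - root j * ((shifts c).2 * (fractions k).2 +
      root l * ((fractions k).1 - (shifts c).2 * (fractions k).2))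
    (∃ e, m = root e * (fractions k).1) ∨ Small z := by decide +kernel

variable {p : ℕ} {s : ZMod p} (h : s ^ 2 + s + 1 = 0)

/-- The ring homomorphism `ω ↦ s`. -/
noncomputable def toZMod : Eisenstein →+* ZMod p :=
  (QuadraticAlgebra.lift ⟨s, by
    rw [neg_smul, neg_smul, one_smul, one_smul]; linear_combination h⟩).toRingHom

theorem toZMod_apply (z : Eisenstein) : toZMod h z = z.re + z.im * s := by
  simp [toZMod]

theorem toZMod_root (i : Fin 3) : toZMod h (root i) = s ^ (i : ℕ) := by
  rw [toZMod_apply]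
  fin_cases i
  · simp [root]
  · simp [root]
  · simp only [root, Fin.reduceFinMk, Matrix.cons_val, Int.reduceNeg, Int.cast_neg, Int.cast_one]
    linear_combination -h

theorem toZMod_ne_zero (hp : 3303 < p) {z : Eisenstein} (hz : Small z) : toZMod h z ≠ 0 := by
  obtain ⟨norm_pos, norm_le⟩ := hz
  intro h0
  refine intCast_zmod_ne_zero (p := p) (n := z.norm) norm_pos.ne' (by omega) ?_
  rw [toZMod_apply] at h0
  rw [QuadraticAlgebra.norm_def]
  push_cast
  linear_combination (z.re - z.im - z.im * s) * h0 + (z.im : ZMod p) ^ 2 * h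

theorem conj_iff_exists_root {a b : ZMod p} :
    Conj s a b ↔ ∃ e, b = toZMod h (root e) * a := by
  simp only [conj_iff_of_cube_eq_one (cube_eq_one_of_rel h), toZMod_root, Fin.exists_fin_succ,
    IsEmpty.exists_iff, or_false]
  simp

theorem exists_conj_of_isConjSum {a b z : ZMod p} (hz : IsConjSum s a b z) :
    ∃ i, Conj s (a + toZMod h (root i) * b) z := by
  simp only [toZMod_root]
  rcases (isConjSum_iff_of_cube_eq_one (cube_eq_one_of_rel h)).1 hz with hz | hz | hz
  · exact ⟨0, by simpa using hz⟩
  · exact ⟨1, by simpa using hz⟩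
  · exact ⟨2, by simpa using hz⟩

end Eisenstein

section Residues

/-- The hypothesis says that a conjugate sum of `1` and `2k` is conjugate to one of `k` and `k + 1`;
each choice of `x`, `y`, `z` gives a linear equation for `k`. -/
theorem eq_mul_of_forall_fraction_ne {R : Type*} [Field R] {s k x y z : R} (h : s ^ 2 + s + 1 = 0)
    (h3 : (3 : R) ≠ 0) (h1 : k ≠ 1) (e1 : (2 * k + 1) * (2 * s + 1) ≠ 3)
    (e2 : (2 * k + 1) * (2 * s + 1) ≠ -3) (e3 : (2 * k + 1) * (3 * s) ≠ s - 4)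
    (e4 : (2 * k + 1) * (2 * s + 1) ≠ 4 * s - 1) (e5 : (2 * k + 1) * (3 * (s + 1)) ≠ s + 5)
    (e6 : (2 * k + 1) * (2 * s + 1) ≠ 4 * s + 5) (hx : x = 1 ∨ x = s ∨ x = -s - 1)
    (hy : y = 1 ∨ y = s ∨ y = -s - 1) (hz : z = 1 ∨ z = s ∨ z = -s - 1)
    (e : 1 + x * (2 * k) = z * (k + y * (k + 1))) :
    1 + x * (2 * k) = 2 * k + 1 ∨ 1 + x * (2 * k) = s * (2 * k + 1) ∨
      1 + x * (2 * k) = (-s - 1) * (2 * k + 1) := by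
  rcases hx with rfl | rfl | rfl
  · left; ring
  all_goals rcases hy with rfl | rfl | rfl <;> rcases hz with rfl | rfl | rfl <;> grind

open Eisenstein

variable {p : ℕ} [Fact p.Prime] {s : ZMod p}

theorem mem_exceptional_iff_mul (h : s ^ 2 + s + 1 = 0) (hp : 3303 < p) (t : ZMod p) :
    t ∈ exceptional p s ↔ t * (2 * s + 1) = 3 ∨ t * (2 * s + 1) = -3 ∨
      t * (3 * s) = s - 4 ∨ t * (2 * s + 1) = 4 * s - 1 ∨ t * (3 * (s + 1)) = s + 5 ∨
        t * (2 * s + 1) = 4 * s + 5 := by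
  have ne_zero {a : ZMod p} (k : Fin 6) (ha : a = toZMod h (fractions k).2) : a ≠ 0 :=
    ha ▸ toZMod_ne_zero h hp (small_snd_fractions k)
  have h0 : 2 * s + 1 ≠ 0 := ne_zero 0 (by simp [toZMod_apply, fractions]; ring)
  have h2 : 3 * s ≠ 0 := ne_zero 2 (by simp [toZMod_apply, fractions])
  have h4 : 3 * (s + 1) ≠ 0 := ne_zero 4 (by simp [toZMod_apply, fractions]; ring)
  simp only [exceptional, Set.mem_insert_iff, Set.mem_singleton_iff, eq_div_iff h0, eq_div_iff h2,
    eq_div_iff h4]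

theorem mem_exceptional_iff (h : s ^ 2 + s + 1 = 0) (hp : 3303 < p) (t : ZMod p) :
    t ∈ exceptional p s ↔ ∃ k, t * toZMod h (fractions k).2 = toZMod h (fractions k).1 := by
  rw [mem_exceptional_iff_mul h hp]
  simp only [toZMod_apply, fractions, Fin.exists_fin_succ, IsEmpty.exists_iff, or_false]
  simp
  ring_nf

theorem intCast_notMem_exceptional (h : s ^ 2 + s + 1 = 0) (hp : 3303 < p) {n : ℤ}
    (hn : n ∈ Finset.Icc (-14) 14) : (n : ZMod p) ∉ exceptional p s := by
  rw [mem_exceptional_iff h hp, not_exists]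
  intro k hk
  refine toZMod_ne_zero h hp (small_mul_fractions_sub n hn k) ?_
  rw [map_sub, map_mul, map_intCast, hk, sub_self]

theorem conj_of_isConjSum_shifts (h : s ^ 2 + s + 1 = 0) (hp : 3303 < p) {t z : ZMod p}
    (ht : t ∈ exceptional p s) (c : Fin 4)
    (h₁ : IsConjSum s (shifts c).1 (t - (shifts c).1) z)
    (h₂ : IsConjSum s (shifts c).2 (t - (shifts c).2) z) : Conj s t z := by
  obtain ⟨k, hk⟩ := (mem_exceptional_iff h hp t).1 ht
  obtain ⟨i, hi⟩ := exists_conj_of_isConjSum h h₁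
  obtain ⟨l, hl⟩ := exists_conj_of_isConjSum h h₂
  obtain ⟨j, hj⟩ := (conj_iff_exists_root h).1 (hl.trans (hi.symm (cube_eq_one_of_rel h)))
  refine .trans ((conj_iff_exists_root h).2 ?_) hi
  rcases eq_root_mul_fractions_or_small k c i j l with ⟨e, he⟩ | small
  · refine ⟨e, mul_right_cancel₀ (toZMod_ne_zero h hp (small_snd_fractions k)) ?_⟩
    have := congrArg (toZMod h) he
    simp only [map_add, map_mul, map_sub, map_intCast] at this
    linear_combination this + (toZMod h (root i) - toZMod h (root e)) * hk
  · refine absurd ?_ (toZMod_ne_zero h hp small)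
    simp only [map_add, map_mul, map_sub, map_intCast]
    linear_combination toZMod h (fractions k).2 * hj + (toZMod h (root j) * toZMod h (root l) -
      toZMod h (root i)) * hk

theorem conj_of_isConjSum_of_notMem_exceptional (h : s ^ 2 + s + 1 = 0) (hp : 3303 < p)
    {k z : ZMod p} (hk : 2 * k + 1 ∉ exceptional p s) (h1 : k ≠ 1)
    (h₁ : IsConjSum s 1 (2 * k) z) (h₂ : IsConjSum s k (k + 1) z) : Conj s (2 * k + 1) z := by
  obtain ⟨i, hi⟩ := exists_conj_of_isConjSum h h₁
  obtain ⟨l, hl⟩ := exists_conj_of_isConjSum h h₂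
  obtain ⟨j, hj⟩ := (conj_iff_exists_root h).1 (hl.trans (hi.symm (cube_eq_one_of_rel h)))
  have three_ne_zero : (3 : ZMod p) ≠ 0 := by
    exact_mod_cast intCast_zmod_ne_zero (p := p) (n := 3) (by norm_num) (by norm_num; omega)
  have root_cases (e : Fin 3) : toZMod h (root e) = 1 ∨ toZMod h (root e) = s ∨
      toZMod h (root e) = -s - 1 := by
    fin_cases e <;> simp [toZMod_apply, root, sub_eq_add_neg, add_comm]
  simp only [mem_exceptional_iff_mul h hp, not_or] at hk
  obtain ⟨e1, e2, e3, e4, e5, e6⟩ := hk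
  have sq_eq : -s - 1 = s ^ 2 := by linear_combination -h
  refine .trans ((conj_iff_of_cube_eq_one (cube_eq_one_of_rel h)).2 ?_) hi
  simpa only [sq_eq] using eq_mul_of_forall_fraction_ne h three_ne_zero h1 e1 e2 e3 e4 e5 e6
    (root_cases i) (root_cases l) (root_cases j) hj

end Residues

section Computes

variable {F : Type*} [Field F] [Fintype F] {K : Type*} [Field K] [DecidableEq K] [Algebra F K]
  {A B : F}

/-- The computation `x` succeeds, and its result is the line of `pt a`. -/
def Computes {R : Type*} [Ring R] (pt : R →+ Points K A B) (x : Option (Line F)) (a : R) : Prop :=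
  ∃ L : Line F, x = some L ∧ IsLineOf L (pt a)

namespace TraceZeroParam

section IsDomain

variable {R : Type*} [CommRing R] [IsDomain R] {s : R} {pt : R →+ Points K A B}
  {x x₁ x₂ x₃ x₄ : Option (Line F)} {a b c d t : R}

theorem computes_D (H : TraceZeroParam s pt) (h : Computes pt x a) :
    Computes pt (D A B x) (2 * a) := by
  obtain ⟨L, rfl, hL⟩ := h
  exact H.isLineOf_dbl hL

theorem computes_lineOf (H : TraceZeroParam s pt) (ha : a ≠ 0) :
    Computes pt (lineOf (pt a)) a :=
  have exists_line := H.exists_isLineOf ha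
  ⟨exists_line.choose, dif_pos exists_line, exists_line.choose_spec⟩

theorem computes_lineOf_zsmul (H : TraceZeroParam s pt) {n : ℤ} (hn : (n : R) ≠ 0) :
    Computes pt (lineOf (n • pt 1)) n := by
  rw [← map_zsmul, zsmul_one]
  exact H.computes_lineOf hn

theorem computes_Subalg (H : TraceZeroParam s pt) (h2 : ringChar F ≠ 2)
    {enum : Finset F[X] → List F[X]} (henum : ∀ Z : Finset F[X], (enum Z : Multiset F[X]) = Z.val)
    (h₁ : Computes pt x₁ a) (h₂ : Computes pt x₂ b) (h₃ : Computes pt x₃ c)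
    (h₄ : Computes pt x₄ d) (habt : a + b = t) (hcdt : c + d = t) (ht : t ≠ 0) (hab : a ≠ b)
    (hcd : c ≠ d) (hC : ∀ z, IsConjSum s a b z → IsConjSum s c d z → Conj s t z) :
    Computes pt (Subalg enum A B x₁ x₂ x₃ x₄) t := by
  obtain ⟨M₁, rfl, hM₁⟩ := h₁
  obtain ⟨M₂, rfl, hM₂⟩ := h₂
  obtain ⟨N₁, rfl, hN₁⟩ := h₃
  obtain ⟨N₂, rfl, hN₂⟩ := h₄
  subst habt
  exact H.subalg_eq_some h2 henum hM₁ hM₂ hN₁ hN₂ hcdt.symm ht hab hcd hC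

end IsDomain

variable {p : ℕ} [Fact p.Prime] {s : ZMod p} {pt : ZMod p →+ Points K A B}
  {x₁ x₂ x₃ x₄ : Option (Line F)}

theorem computes_Subalg_of_notMem_exceptional (H : TraceZeroParam s pt) (h2 : ringChar F ≠ 2)
    (hp : 3303 < p) {enum : Finset F[X] → List F[X]}
    (henum : ∀ Z : Finset F[X], (enum Z : Multiset F[X]) = Z.val) {k : ZMod p}
    (h₁ : Computes pt x₁ 1) (h₂ : Computes pt x₂ (2 * k)) (h₃ : Computes pt x₃ k)
    (h₄ : Computes pt x₄ (k + 1)) (hk : 2 * k + 1 ∉ exceptional p s) (hk0 : 2 * k + 1 ≠ 0)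
    (hk1 : k ≠ 1) (hk2 : 1 ≠ 2 * k) :
    Computes pt (Subalg enum A B x₁ x₂ x₃ x₄) (2 * k + 1) :=
  H.computes_Subalg h2 henum h₁ h₂ h₃ h₄ (by ring) (by ring) hk0 hk2 (by simp)
    fun _ => conj_of_isConjSum_of_notMem_exceptional H.rel hp hk hk1

open Eisenstein in
theorem computes_Subalg_of_mem_exceptional (H : TraceZeroParam s pt) (h2 : ringChar F ≠ 2)
    (hp : 3303 < p) {enum : Finset F[X] → List F[X]}
    (henum : ∀ Z : Finset F[X], (enum Z : Multiset F[X]) = Z.val) {t : ZMod p} (c : Fin 4)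
    (h₁ : Computes pt x₁ (shifts c).1) (h₂ : Computes pt x₂ (t - (shifts c).1))
    (h₃ : Computes pt x₃ (shifts c).2) (h₄ : Computes pt x₄ (t - (shifts c).2))
    (ht : t ∈ exceptional p s) (ht0 : t ≠ 0) :
    Computes pt (Subalg enum A B x₁ x₂ x₃ x₄) t := by
  have ne_sub {n : ℤ} (hn : 2 * n ∈ Finset.Icc (-14) 14) : (n : ZMod p) ≠ t - n := fun h =>
    intCast_notMem_exceptional H.rel hp hn (by
      rwa [show ((2 * n : ℤ) : ZMod p) = t by push_cast; linear_combination h])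
  exact H.computes_Subalg h2 henum h₁ h₂ h₃ h₄ (by ring) (by ring) ht0
    (ne_sub (by fin_cases c <;> decide)) (ne_sub (by fin_cases c <;> decide))
    fun _ => conj_of_isConjSum_shifts H.rel hp ht c

end TraceZeroParam

end Computes

section BinPrefix

theorem binPrefix_eq (m i : ℕ) :
    binPrefix m i = 2 * binPrefix m (i + 1) + (m.testBit i).toNat := by
  rw [binPrefix, binPrefix, pow_succ, ← Nat.div_div_eq_div_mul, Nat.toNat_testBit]
  exact (Nat.div_add_mod _ 2).symm

theorem cast_binPrefix {R : Type*} [Semiring R] (m i : ℕ) :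
    (binPrefix m i : R) = 2 * binPrefix m (i + 1) + (m.testBit i).toNat := by
  rw [binPrefix_eq m i]
  push_cast
  rfl

theorem binPrefix_le (m i : ℕ) : binPrefix m i ≤ m := Nat.div_le_self _ _

theorem binPrefix_pos {m i : ℕ} (h : i < m.size) : 0 < binPrefix m i :=
  Nat.div_pos (Nat.lt_size.1 h) (by positivity)

theorem binPrefix_of_succ_eq_size {m i : ℕ} (h : i + 1 = m.size) : binPrefix m i = 1 := by
  have lt_two : binPrefix m i < 2 := by
    rw [binPrefix, Nat.div_lt_iff_lt_mul (by positivity), ← pow_succ', h]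
    exact Nat.lt_size_self m
  have pos := binPrefix_pos (m := m) (i := i) (by omega)
  omega

theorem binPrefix_succ_add_one_lt {m i p : ℕ} (hm : m < p) (hi : i + 1 < m.size) :
    binPrefix m (i + 1) + 1 < p := by
  have pos := binPrefix_pos hi
  have eq := binPrefix_eq m i
  have le := binPrefix_le m i
  omega

theorem mem_oddExceptional_iff {p : ℕ} [Fact p.Prime] {s : ZMod p} {m i : ℕ}
    (h : 2 * binPrefix m (i + 1) + 1 < p) :
    (binPrefix m i ∈ oddExceptional p s ∨ binPrefix m i + 1 ∈ oddExceptional p s) ↔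
      2 * (binPrefix m (i + 1) : ZMod p) + 1 ∈ exceptional p s := by
  rw [binPrefix_eq m i]
  cases m.testBit i <;> simp [oddExceptional, Nat.odd_add_one, h]

end BinPrefix

section Ladder

variable {F : Type*} [Field F] [Fintype F] {K : Type*} [Field K] [DecidableEq K] [Algebra F K]
  {A B : F} {p : ℕ} [Fact p.Prime]

/-- The line `w_i` of the special case. -/
noncomputable def specialSum (enum : Finset F[X] → List F[X]) (P : Points K A B) (s : ZMod p)
    (m i : ℕ) : Option (Line F) :=
  let h : ℤ → Option (Line F) := fun n => lineOf (n • P)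
  let u₂ := (ladder enum P p s m (i + 2)).1
  let v₂ := (ladder enum P p s m (i + 2)).2
  let u₃ := (ladder enum P p s m (i + 3)).1
  let v₃ := (ladder enum P p s m (i + 3)).2
  match m.testBit (i + 1), m.testBit (i + 2) with
  | true, true => Subalg enum A B (h 3) (D A B (D A B u₂)) (h 7) (D A B (D A B (D A B u₃)))
  | true, false =>
    Subalg enum A B (h 3) (D A B (D A B (D A B u₃))) (h (-5)) (D A B (D A B (D A B v₃)))
  | false, true =>
    Subalg enum A B (h (-3)) (D A B (D A B (D A B v₃))) (h 5) (D A B (D A B (D A B u₃)))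
  | false, false =>
    Subalg enum A B (h (-3)) (D A B (D A B v₂)) (h (-7)) (D A B (D A B (D A B v₃)))

open Classical in
/-- The line `w_i`. -/
noncomputable def ladderSum (enum : Finset F[X] → List F[X]) (P : Points K A B) (s : ZMod p)
    (m i : ℕ) : Option (Line F) :=
  if binPrefix m i ∈ oddExceptional p s ∨ binPrefix m i + 1 ∈ oddExceptional p s then
    specialSum enum P s m i
  else
    let u := (ladder enum P p s m (i + 1)).1
    Subalg enum A B (lineOf ((1 : ℤ) • P)) (D A B u) u (ladder enum P p s m (i + 1)).2

/-- The assertion of the proposition on `u_i` and `v_i`, for `P = pt 1`. -/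
def LadderCorrect (pt : ZMod p →+ Points K A B) (enum : Finset F[X] → List F[X]) (s : ZMod p)
    (m i : ℕ) : Prop :=
  Computes pt (ladder enum (pt 1) p s m i).1 (binPrefix m i) ∧
    (binPrefix m i + 1 ≠ p → Computes pt (ladder enum (pt 1) p s m i).2 (binPrefix m i + 1))

variable {s : ZMod p} {enum : Finset F[X] → List F[X]} {m i : ℕ}

theorem ladder_of_succ_eq_size {P : Points K A B} (h : i + 1 = m.size) :
    ladder enum P p s m i = (lineOf ((1 : ℤ) • P), lineOf ((2 : ℤ) • P)) := by
  rw [ladder, if_neg (by omega), if_pos h]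

theorem ladder_of_add_two_eq_size {P : Points K A B} (h : i + 2 = m.size) :
    ladder enum P p s m i = if m.testBit i then (lineOf ((3 : ℤ) • P), lineOf ((4 : ℤ) • P))
      else (lineOf ((2 : ℤ) • P), lineOf ((3 : ℤ) • P)) := by
  rw [ladder, if_neg (by omega), if_neg (by omega), if_pos h]

theorem ladder_of_add_two_lt_size {P : Points K A B} (h : i + 2 < m.size) :
    ladder enum P p s m i =
      if m.testBit i then (ladderSum enum P s m i, D A B (ladder enum P p s m (i + 1)).2)
      else (D A B (ladder enum P p s m (i + 1)).1, ladderSum enum P s m i) := by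
  rw [ladder, if_neg (by omega), if_neg (by omega), if_neg (by omega)]
  rfl

theorem add_three_lt_size_of_mem_exceptional (rel : s ^ 2 + s + 1 = 0) (hp : 3303 < p)
    (hi : i + 2 < m.size) (h : 2 * (binPrefix m (i + 1) : ZMod p) + 1 ∈ exceptional p s) :
    i + 3 < m.size := by
  by_contra not_lt
  rw [cast_binPrefix, binPrefix_of_succ_eq_size (i := i + 1 + 1) (by omega)] at h
  cases bit : m.testBit (i + 1)
  · refine intCast_notMem_exceptional rel hp (n := 5) (by decide) ?_
    convert h using 1
    simp only [bit, Bool.toNat_false]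
    norm_num
  · refine intCast_notMem_exceptional rel hp (n := 7) (by decide) ?_
    convert h using 1
    simp only [bit, Bool.toNat_true]
    norm_num

namespace LadderCorrect

variable {pt : ZMod p →+ Points K A B}

theorem computes_snd (h : LadderCorrect pt enum s m (i + 1)) (hm : m < p) (hi : i + 1 < m.size) :
    Computes pt (ladder enum (pt 1) p s m (i + 1)).2 (binPrefix m (i + 1) + 1) :=
  h.2 (binPrefix_succ_add_one_lt hm hi).ne

end LadderCorrect

namespace TraceZeroParam

variable {pt : ZMod p →+ Points K A B}

theorem computes_lineOf_small (H : TraceZeroParam s pt) (hp : 3303 < p) {n : ℤ} {a : ZMod p}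
    (hn : n ∈ Finset.Icc (-7) 7) (h0 : n ≠ 0) (ha : (n : ZMod p) = a) :
    Computes pt (lineOf (n • pt 1)) a := by
  rw [Finset.mem_Icc] at hn
  exact ha ▸ H.computes_lineOf_zsmul (intCast_zmod_ne_zero h0 (by omega))

theorem computes_specialSum (H : TraceZeroParam s pt) (h2 : ringChar F ≠ 2) (hp : 3303 < p)
    (henum : ∀ Z : Finset F[X], (enum Z : Multiset F[X]) = Z.val) (hm : m < p)
    (hi : i + 3 < m.size) (correct₂ : LadderCorrect pt enum s m (i + 2))
    (correct₃ : LadderCorrect pt enum s m (i + 3))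
    (ht : 2 * (binPrefix m (i + 1) : ZMod p) + 1 ∈ exceptional p s)
    (ht0 : 2 * (binPrefix m (i + 1) : ZMod p) + 1 ≠ 0) :
    Computes pt (specialSum enum (pt 1) s m i) (2 * binPrefix m (i + 1) + 1) := by
  have hv₂ := correct₂.computes_snd hm (by omega)
  have hv₃ := correct₃.computes_snd hm hi
  have eq₁ := cast_binPrefix (R := ZMod p) m (i + 1)
  have eq₂ := cast_binPrefix (R := ZMod p) m (i + 2)
  have shift {n : ℤ} (h : n ∈ Finset.Icc (-7) 7) (h0 : n ≠ 0) :=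
    H.computes_lineOf_small hp h h0 rfl
  have double₂ {x : Option (Line F)} {a b : ZMod p} (h : Computes pt x a) (e : 2 * (2 * a) = b) :
      Computes pt (D A B (D A B x)) b := e ▸ H.computes_D (H.computes_D h)
  have double₃ {x : Option (Line F)} {a b : ZMod p} (h : Computes pt x a)
      (e : 2 * (2 * (2 * a)) = b) : Computes pt (D A B (D A B (D A B x))) b :=
    e ▸ H.computes_D (H.computes_D (H.computes_D h))
  unfold specialSum
  cases bit₁ : m.testBit (i + 1) <;> cases bit₂ : m.testBit (i + 2) <;>
    simp only [bit₁, bit₂, Bool.toNat_false, Bool.toNat_true, Nat.cast_zero, Nat.cast_one]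
      at eq₁ eq₂ ⊢
  · refine H.computes_Subalg_of_mem_exceptional h2 hp henum 3 (shift (by decide) (by decide))
      (double₂ hv₂ ?_) (shift (by decide) (by decide)) (double₃ hv₃ ?_) ht ht0
    all_goals rw [eq₁, eq₂]; simp [Eisenstein.shifts]; ring
  · refine H.computes_Subalg_of_mem_exceptional h2 hp henum 2 (shift (by decide) (by decide))
      (double₃ hv₃ ?_) (shift (by decide) (by decide)) (double₃ correct₃.1 ?_) ht ht0
    all_goals rw [eq₁, eq₂]; simp [Eisenstein.shifts]; ring
  · refine H.computes_Subalg_of_mem_exceptional h2 hp henum 1 (shift (by decide) (by decide))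
      (double₃ correct₃.1 ?_) (shift (by decide) (by decide)) (double₃ hv₃ ?_) ht ht0
    all_goals rw [eq₁, eq₂]; simp [Eisenstein.shifts]; ring
  · refine H.computes_Subalg_of_mem_exceptional h2 hp henum 0 (shift (by decide) (by decide))
      (double₂ correct₂.1 ?_) (shift (by decide) (by decide)) (double₃ correct₃.1 ?_) ht ht0
    all_goals rw [eq₁, eq₂]; simp [Eisenstein.shifts]; ring

theorem computes_ladderSum (H : TraceZeroParam s pt) (h2 : ringChar F ≠ 2) (hp : 3303 < p)
    (henum : ∀ Z : Finset F[X], (enum Z : Multiset F[X]) = Z.val) (hm : m < p)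
    (hi : i + 2 < m.size) (correct : ∀ j, i < j → j < m.size → LadderCorrect pt enum s m j)
    (hlt : 2 * binPrefix m (i + 1) + 1 < p) :
    Computes pt (ladderSum enum (pt 1) s m i) (2 * binPrefix m (i + 1) + 1) := by
  have ht0 : 2 * (binPrefix m (i + 1) : ZMod p) + 1 ≠ 0 := by
    exact_mod_cast intCast_zmod_ne_zero (n := 2 * binPrefix m (i + 1) + 1) (by omega) (by omega)
  by_cases ht : 2 * (binPrefix m (i + 1) : ZMod p) + 1 ∈ exceptional p s
  · have hi₃ := add_three_lt_size_of_mem_exceptional H.rel hp hi ht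
    rw [ladderSum, if_pos ((mem_oddExceptional_iff hlt).2 ht)]
    exact H.computes_specialSum h2 hp henum hm hi₃ (correct _ (by omega) hi)
      (correct _ (by omega) hi₃) ht ht0
  · rw [ladderSum, if_neg (mt (mem_oddExceptional_iff hlt).1 ht)]
    have correct₁ := correct (i + 1) (by omega) (by omega)
    have prefix_eq : binPrefix m (i + 1) = 2 * binPrefix m (i + 2) + _ := binPrefix_eq m (i + 1)
    have prefix_pos := binPrefix_pos hi
    refine H.computes_Subalg_of_notMem_exceptional h2 hp henum
      (H.computes_lineOf_small hp (by decide) (by decide) (by norm_num)) (H.computes_D correct₁.1)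
      correct₁.1 (correct₁.computes_snd hm (by omega)) ht ht0 (fun h => ?_) (fun h => ?_)
    · refine intCast_zmod_ne_zero (p := p) (n := binPrefix m (i + 1) - 1) (by omega) (by omega) ?_
      push_cast
      linear_combination h
    · refine intCast_zmod_ne_zero (p := p) (n := 2 * binPrefix m (i + 1) - 1) (by omega)
        (by omega) ?_
      push_cast
      linear_combination -h

theorem ladderCorrect_of_succ_eq_size (H : TraceZeroParam s pt) (hp : 3303 < p)
    (hi : i + 1 = m.size) : LadderCorrect pt enum s m i := by
  rw [LadderCorrect, ladder_of_succ_eq_size hi, binPrefix_of_succ_eq_size hi]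
  exact ⟨H.computes_lineOf_small hp (by decide) (by decide) (by norm_num),
    fun _ => H.computes_lineOf_small hp (by decide) (by decide) (by norm_num)⟩

theorem ladderCorrect_of_add_two_eq_size (H : TraceZeroParam s pt) (hp : 3303 < p)
    (hi : i + 2 = m.size) : LadderCorrect pt enum s m i := by
  rw [LadderCorrect, ladder_of_add_two_eq_size hi, cast_binPrefix,
    binPrefix_of_succ_eq_size (i := i + 1) hi]
  cases m.testBit i <;>
    exact ⟨H.computes_lineOf_small hp (by decide) (by decide) (by norm_num),
      fun _ => H.computes_lineOf_small hp (by decide) (by decide) (by norm_num)⟩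

theorem ladderCorrect_of_add_two_lt_size (H : TraceZeroParam s pt) (h2 : ringChar F ≠ 2)
    (hp : 3303 < p) (henum : ∀ Z : Finset F[X], (enum Z : Multiset F[X]) = Z.val) (hm : m < p)
    (hi : i + 2 < m.size) (correct : ∀ j, i < j → j < m.size → LadderCorrect pt enum s m j) :
    LadderCorrect pt enum s m i := by
  have sum := H.computes_ladderSum h2 hp henum hm hi correct
  have correct₁ := correct (i + 1) (by omega) (by omega)
  have prefix_eq := binPrefix_eq m i
  have prefix_le := binPrefix_le m i
  rw [LadderCorrect, ladder_of_add_two_lt_size hi, cast_binPrefix]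
  cases bit : m.testBit i <;> simp only [bit, Bool.toNat_false, Bool.toNat_true] at prefix_eq
  · refine ⟨?_, fun h => ?_⟩
    · simpa using H.computes_D correct₁.1
    · simpa using sum (by omega)
  · refine ⟨?_, fun _ => ?_⟩
    · simpa using sum (by omega)
    · have double := H.computes_D (correct₁.computes_snd hm (by omega))
      rw [mul_add_one, ← one_add_one_eq_two, ← add_assoc, one_add_one_eq_two] at double
      simpa using double

theorem ladderCorrect (H : TraceZeroParam s pt) (h2 : ringChar F ≠ 2) (hp : 3303 < p)
    (henum : ∀ Z : Finset F[X], (enum Z : Multiset F[X]) = Z.val) (hm : m < p) (hi : i < m.size) :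
    LadderCorrect pt enum s m i := by
  induction hn : m.size - i using Nat.strong_induction_on generalizing i with
  | _ n ih =>
    obtain hi | hi | hi : i + 1 = m.size ∨ i + 2 = m.size ∨ i + 2 < m.size := by omega
    · exact H.ladderCorrect_of_succ_eq_size hp hi
    · exact H.ladderCorrect_of_add_two_eq_size hp hi
    · exact H.ladderCorrect_of_add_two_lt_size h2 hp henum hm hi fun j hij hj =>
        ih _ (by omega) hj rfl

end TraceZeroParam

end Ladder

section Generator

variable {F : Type*} [Field F] [Fintype F] {K : Type*} [Field K] [DecidableEq K] [Algebra F K]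
  {A B : F}

theorem exists_injective_zmod_hom {G : Type*} [AddGroup G] {P : G} {p : ℕ}
    (hP : addOrderOf P = p) : ∃ f : ZMod p →+ G, f 1 = P ∧ Function.Injective f := by
  subst hP
  refine ⟨ZMod.lift _ ⟨zmultiplesHom G P, by simp [addOrderOf_nsmul_eq_zero]⟩, ?_,
    (ZMod.lift_injective _).2 fun n hn => ?_⟩
  · simpa using ZMod.lift_coe (addOrderOf P) ⟨zmultiplesHom G P, by
      simp [addOrderOf_nsmul_eq_zero]⟩ 1
  · rw [ZMod.intCast_zmod_eq_zero_iff_dvd, addOrderOf_dvd_iff_zsmul_eq_zero]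
    simpa using hn

theorem exists_traceZeroParam (h2 : ringChar F ≠ 2) (hK : Module.finrank F K = 3) {p : ℕ}
    (hp : 3 < p) {P : Points K A B} (hP : addOrderOf P = p) (hT : P ∈ traceZero K A B)
    {s : ZMod p} (hs : frob P = s.val • P) :
    ∃ pt : ZMod p →+ Points K A B, TraceZeroParam s pt ∧ pt 1 = P := by
  have : NeZero p := ⟨by omega⟩
  obtain ⟨pt, rfl, injective⟩ := exists_injective_zmod_hom hP
  have pt_eq (a : ZMod p) : pt a = a.val • pt 1 := by
    rw [← map_nsmul, nsmul_one, ZMod.natCast_zmod_val]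
  have frob_pt (a : ZMod p) : frob (pt a) = pt (s * a) := by
    rw [pt_eq a, map_nsmul, hs, ← map_nsmul, ← map_nsmul, nsmul_one, nsmul_eq_mul,
      ZMod.natCast_zmod_val, ZMod.natCast_zmod_val, mul_comm]
  refine ⟨pt, ⟨hK, ?_, ?_, ?_, injective, frob_pt, ?_⟩, rfl⟩
  · simpa only [map_ofNat] using (map_ne_zero (algebraMap F K)).2 (Ring.two_ne_zero h2)
  · exact_mod_cast intCast_zmod_ne_zero (p := p) (n := 2) (by decide) (by omega)
  · exact_mod_cast intCast_zmod_ne_zero (p := p) (n := 3) (by decide) (by omega)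
  · have trace_eq_zero : pt 1 + frob (pt 1) + frob (frob (pt 1)) = 0 := hT
    rw [frob_pt, frob_pt, ← map_add, ← map_add, map_eq_zero_iff _ injective] at trace_eq_zero
    linear_combination trace_eq_zero

end Generator

end T3

theorem mainTheorem3_general {F K : Type*} [Field F] [Fintype F] [Field K] [DecidableEq K]
    [Algebra F K] (h2 : ringChar F ≠ 2) (hK : Module.finrank F K = 3) (A B : F)
    (p : ℕ) [Fact p.Prime] (hp : 3303 < p)
    (P : T3.Points K A B) (hP : addOrderOf P = p) (hT : P ∈ T3.traceZero K A B)
    (s : ZMod p) (hs : T3.frob P = s.val • P)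
    (enum : Finset (Polynomial F) → List (Polynomial F))
    (henum : ∀ Z : Finset (Polynomial F), (enum Z : Multiset (Polynomial F)) = Z.val)
    (m : ℕ) (hmp : m < p) :
    ∀ i < m.size,
      (∃ u : T3.Line F, (T3.ladder enum P p s m i).1 = some u ∧
        T3.IsLineOf u (T3.binPrefix m i • P)) ∧
      (T3.binPrefix m i + 1 ≠ p →
        ∃ v : T3.Line F, (T3.ladder enum P p s m i).2 = some v ∧
          T3.IsLineOf v ((T3.binPrefix m i + 1) • P)) := by
  intro i hi
  obtain ⟨pt, H, rfl⟩ := T3.exists_traceZeroParam h2 hK (by omega) hP hT hs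
  have nsmul_pt_one (n : ℕ) : n • pt 1 = pt n := by rw [← map_nsmul, nsmul_one]
  rw [nsmul_pt_one, nsmul_pt_one, Nat.cast_add, Nat.cast_one]
  exact H.ladderCorrect h2 hp henum hmp hi

theorem mainTheorem3 {F K : Type*} [Field F] [Fintype F] [Field K] [DecidableEq K] [Algebra F K]
    (h2 : ringChar F ≠ 2) (h3 : ringChar F ≠ 3) (hK : Module.finrank F K = 3)
    (A B : F) (hAB : 4 * A ^ 3 + 27 * B ^ 2 ≠ 0)
    (p : ℕ) [Fact p.Prime] (hp : 10800 < p)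
    (P : T3.Points K A B) (hP : addOrderOf P = p)
    (hT : T3.traceZero K A B = AddSubgroup.zmultiples P)
    (s : ZMod p) (hs : T3.frob P = s.val • P)
    (enum : Finset (Polynomial F) → List (Polynomial F))
    (henum : ∀ Z : Finset (Polynomial F), (enum Z : Multiset (Polynomial F)) = Z.val)
    (m : ℕ) (hm0 : 0 < m) (hmp : m < p) :
    ∀ i < m.size,
      (∃ u : T3.Line F, (T3.ladder enum P p s m i).1 = some u ∧
        T3.IsLineOf u (T3.binPrefix m i • P)) ∧
      (T3.binPrefix m i + 1 ≠ p →
        ∃ v : T3.Line F, (T3.ladder enum P p s m i).2 = some v ∧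
          T3.IsLineOf v ((T3.binPrefix m i + 1) • P)) :=
  mainTheorem3_general h2 hK A B p (by omega) P hP (hT ▸ AddSubgroup.mem_zmultiples P) s hs enum
    henum m hmp
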